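/- Write $q=x_0+\vec q=x_0+x_1i+x_2j+x_3k\in\mathbb H$, let $\mathbb S=\{I\in\mathbb H: I^2=-1\}$ and, for $I\in\mathbb S$, let $\mathbb C_I=\mathbb R+I\mathbb R$. An axially symmetric slice domain is a domain $\Omega\subseteq\mathbb H$ that meets $\mathbb R$, such that $\Omega\cap\mathbb C_I$ is a domain of $\mathbb C_I$ for every $I\in\mathbb S$, and such that $x+Iy\in\Omega$ implies $x+Jy\in\Omega$ for all $J\in\mathbb S$. Put $\overline{\partial_I}=\frac12(\partial_x+I\partial_y)$ on functions of $x+Iy$. A function $f:\Omega\to\mathbb H$ is a slice function if $f(x+Iy)=\alpha(x,y)+I\beta(x,y)$ for all $I\in\mathbb S$, with $\mathbb H$-valued $\alpha,\beta$ not depending on $I$, $\alpha$ even and $\beta$ odd in $y$. It is slice hyperholomorphic if it is $C^1$ and $\overline{\partial_I}f=0$ on $\Omega\cap\mathbb C_I$ for every $I\in\mathbb S$. It is slice polyanalytic of order $n$ if it is a slice function of class $C^n$ with $\overline{\partial_I}^{\,n}f=0$ on $\Omega\cap\mathbb C_I$ for every $I\in\mathbb S$. Let $$\mathcal D=\partial_{x_0}+i\,\partial_{x_1}+j\,\partial_{x_2}+k\,\partial_{x_3},\qquad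 Vf=\partial_{x_0}f+\frac{\vec q}{|\vec q\,|^2}\sum_{l=1}^3x_l\,\partial_{x_l}f\quad(q\notin\mathbb R),$$ where $Vf$ also denotes the continuous extension to $\Omega$ whenever there is one, and let $\Delta=\sum_{l=0}^3\partial_{x_l}^2$. A function is poly-Fueter regular of order $n$ (Fueter regular if $n=1$) if it is $C^n$ and $\mathcal D^n$ annihilates it. **Theorem.** Let $n\ge1$, let $\Omega$ be an axially symmetric slice domain, and let $f:\Omega\to\mathbb H$ be slice polyanalytic of order $n$. Then: 1. There are slice hyperholomorphic functions $f_0,\dots,f_{n-1}$ on $\Omega$ with $f(q)=\sum_{k=0}^{n-1}\overline q^{\,k}f_k(q)$ on $\Omega$. They are unique, and they are slice functions of class $C^2$. Hence $$\mathcal C_n(f)(q)=\sum_{k=0}^{n-1}x_0^k\,\Delta f_k(q)\qquad(q\in\Omega)$$ is well defined. It is poly-Fueter regular of order $n$ on $\Omega$. 2. For $0\le m<n-1$ the function $V^m f$ is $C^1$ on $\Omega\setminus\mathbb R$ and $V(V^mf)$ extends continuously to $\Omega$. The function $V^{n-1}f$ is of class $C^2$ on $\Omega$, and $\tau_n(f)=\Delta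 V^{n-1}f$ is Fueter regular on $\Omega$. 3. For every $q\in\Omega$, $$\mathcal D^{n-1}\mathcal C_n(f)(q)=\frac1{2^{n-1}}\,\tau_n(f)(q),$$ equivalently $(2\mathcal D)^{n-1}\mathcal C_n(f)=\tau_n(f)$ on $\Omega$, so the maps $\mathcal C_n$, $(2\mathcal D)^{n-1}$ and $\tau_n$ form a commutative diagram. Moreover, for every $q\in\Omega$, $$\mathcal D^{n-1}\mathcal C_n(f)(q)=(n-1)!\,\Delta f_{n-1}(q),\qquad \tau_n(f)(q)=2^{n-1}(n-1)!\,\Delta f_{n-1}(q).$$ -/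

import Mathlib

open scoped Quaternion

noncomputable section

namespace PolyFueter

/-- The sphere `𝕊` of imaginary units. -/
def imagUnits : Set ℍ := {I | I ^ 2 = -1}

/-- The real axis in `ℍ`. -/
def realAxis : Set ℍ := {q | q.im = 0}

/-- The parametrization `x + iy ↦ x + I y` of the plane `ℂ_I` by `ℂ`. -/
def slicePt (I : ℍ) (z : ℂ) : ℍ := (z.re : ℍ) + I * (z.im : ℍ)

/-- A domain that meets the real axis, all of whose slices `Ω_I` are domains of `ℂ_I`, and that
contains the sphere `x + y𝕊` as soon as it contains one of its points. -/
structure IsAxSymSliceDomain (Ω : Set ℍ) : Prop where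
  isOpen : IsOpen Ω
  isConnected : IsConnected Ω
  inter_real : (Ω ∩ realAxis).Nonempty
  slice_connected : ∀ I ∈ imagUnits, IsConnected (slicePt I ⁻¹' Ω)
  axially_symmetric : ∀ I ∈ imagUnits, ∀ J ∈ imagUnits, ∀ z : ℂ,
    slicePt I z ∈ Ω → slicePt J z ∈ Ω

/-- `f (x + I y) = α (x, y) + I β (x, y)` on `Ω` with `α` even and `β` odd in `y`. -/
def IsSliceFunction (Ω : Set ℍ) (f : ℍ → ℍ) : Prop :=
  ∃ α β : ℝ → ℝ → ℍ,
    (∀ x y, α x (-y) = α x y) ∧ (∀ x y, β x (-y) = -β x y) ∧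
    ∀ I ∈ imagUnits, ∀ z : ℂ, slicePt I z ∈ Ω →
      f (slicePt I z) = α z.re z.im + I * β z.re z.im

/-- The operator `½ (∂/∂x + I ∂/∂y)` on functions of `x + iy`. -/
def dbar (I : ℍ) (g : ℂ → ℍ) (z : ℂ) : ℍ :=
  (1 / 2 : ℝ) • (fderiv ℝ g z 1 + I * fderiv ℝ g z Complex.I)

/-- (Left) slice hyperholomorphic functions on `Ω`. -/
def IsSliceHyperholomorphic (Ω : Set ℍ) (f : ℍ → ℍ) : Prop :=
  ContDiffOn ℝ 1 f Ω ∧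
    ∀ I ∈ imagUnits, ∀ z : ℂ, slicePt I z ∈ Ω → dbar I (f ∘ slicePt I) z = 0

/-- (Left) slice polyanalytic functions of order `n` on `Ω`: the space `SP_n(Ω)`. -/
def IsSlicePolyanalytic (n : ℕ) (Ω : Set ℍ) (f : ℍ → ℍ) : Prop :=
  IsSliceFunction Ω f ∧ ContDiffOn ℝ n f Ω ∧
    ∀ I ∈ imagUnits, ∀ z : ℂ, slicePt I z ∈ Ω → (dbar I)^[n] (f ∘ slicePt I) z = 0

/-- `f = ∑_{k < n} q̄ ^ k φ_k` on `Ω` with slice hyperholomorphic `φ_0, …, φ_{n-1}`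
(the values `φ k` with `n ≤ k` play no role). -/
def IsPolyDecomposition (n : ℕ) (Ω : Set ℍ) (f : ℍ → ℍ) (φ : ℕ → ℍ → ℍ) : Prop :=
  (∀ k < n, IsSliceHyperholomorphic Ω (φ k)) ∧
    ∀ q ∈ Ω, f q = ∑ k ∈ Finset.range n, star q ^ k * φ k q

/-- The components of the poly-decomposition of `f`
(a choice of a decomposition; it is meaningful when one exists). -/
def polyComponent (n : ℕ) (Ω : Set ℍ) (f : ℍ → ℍ) : ℕ → ℍ → ℍ :=
  Classical.epsilon fun φ => IsPolyDecomposition n Ω f φ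

def e₁ : ℍ := ⟨0, 1, 0, 0⟩

def e₂ : ℍ := ⟨0, 0, 1, 0⟩

def e₃ : ℍ := ⟨0, 0, 0, 1⟩

/-- The Cauchy-Fueter operator `𝒟 = ∂₀ + i ∂₁ + j ∂₂ + k ∂₃`. -/
def cauchyFueter (f : ℍ → ℍ) (q : ℍ) : ℍ :=
  fderiv ℝ f q 1 + e₁ * fderiv ℝ f q e₁ + e₂ * fderiv ℝ f q e₂ + e₃ * fderiv ℝ f q e₃

/-- (Left) poly-Fueter regular functions of order `n` on `U`: the space `FR_n(U)`
(the Fueter regular functions for `n = 1`). -/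
def IsPolyFueterRegular (n : ℕ) (U : Set ℍ) (f : ℍ → ℍ) : Prop :=
  ContDiffOn ℝ n f U ∧ ∀ q ∈ U, cauchyFueter^[n] f q = 0

/-- The formula `∂₀ f + (q⃗ / |q⃗|²) ∑ x_l ∂_l f` for the global operator, off the real axis. -/
def globalVOff (f : ℍ → ℍ) (q : ℍ) : ℍ :=
  fderiv ℝ f q 1 + (‖q.im‖ ^ 2)⁻¹ • (q.im *
    (q.imI • fderiv ℝ f q e₁ + q.imJ • fderiv ℝ f q e₂ + q.imK • fderiv ℝ f q e₃))

open Classical in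
/-- The global operator `V`: the formula above off the real axis, and at a real point the limit
of its values at nearby non-real points. -/
def globalV (f : ℍ → ℍ) (q : ℍ) : ℍ :=
  if q ∈ realAxis then Filter.limUnder (nhdsWithin q realAxisᶜ) (globalVOff f) else globalVOff f q

/-- `V f` is a function on `Ω`: `f` is of class `C¹` on `Ω ∖ ℝ`, and `V f` extends continuously
from `Ω ∖ ℝ` to `Ω` (a continuous extension, if there is one, has the values of `globalV f`). -/
def IsVAdmissible (Ω : Set ℍ) (f : ℍ → ℍ) : Prop :=
  ContDiffOn ℝ 1 f (Ω \ realAxis) ∧ ContinuousOn (globalV f) Ω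

/-- The first poly-Fueter map `τ_n = Δ ∘ V ^ (n - 1)`. -/
def polyFueterTau (n : ℕ) (f : ℍ → ℍ) : ℍ → ℍ :=
  Laplacian.laplacian (globalV^[n - 1] f)

/-- The second poly-Fueter map `C_n f = ∑_{k < n} x₀ ^ k Δ f_k`, where the `f_k` are the
components of the poly-decomposition of `f` on `Ω`. -/
def polyFueterC (n : ℕ) (Ω : Set ℍ) (f : ℍ → ℍ) (q : ℍ) : ℍ :=
  ∑ k ∈ Finset.range n, q.re ^ k • Laplacian.laplacian (polyComponent n Ω f k) q

end PolyFueter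

end

open PolyFueter

/-!
Fix an imaginary unit `I`. Left multiplication by `ℂ_I` makes `ℍ` a complex vector space, and
`∂̄_I h = 0` says that `h` is holomorphic for this structure (`IsSliceHolo`). One-variable theory
then applies on the slice `Ω_I`.

*Decomposition.* On one slice, `∂̄_I ^ n F = 0` forces `F = ∑ z̄ ^ k h_k` with holomorphic `h_k`
(`exists_sum_barPow`): a decomposition of `∂̄_I F` is integrated term by term and the remainder is
holomorphic. The formula `½ ((1 - J I) h (z) + (1 + J I) h (z̄))` (`sliceFormula`) extends the `h_k`
from `Ω_I` to `Ω`, and commutes with multiplication by the powers of `q̄`. Conversely, by the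
identity theorem every slice hyperholomorphic function is the extension of its restriction to one
slice (`IsSliceHyperholomorphic.isSliceExt`), hence a slice function; this uses that the slices are
connected and meet the real axis. Such an extension is real analytic
(`IsSliceExt.contDiffOn`): off the real axis because `|q⃗|` is, and at a real point `a` because it
is a power series in `q - a` with coefficients on the right.

*The global operator.* At a non-real point of `ℂ_I`, `V = 2 ∂̄_I` (`globalVOff_eq_dbar`). Thus
`V ^ m f = ∑ 2 ^ m (k! / (k - m)!) q̄ ^ (k - m) f_k`, first off the real axis and then on `Ω`, since
the right-hand side is continuous. For `m = n - 1` only the multiple `2 ^ (n - 1) (n - 1)!` of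
`f_{n-1}` is left.

*Fueter's theorem.* For slice hyperholomorphic `φ = α + I β`, the Cauchy-Riemann equations give
`𝒟 φ = -2 β / |q⃗|` off the real axis, and `Δ (β / |q⃗|) = 0` because `β` is harmonic; so
`𝒟 Δ φ = Δ 𝒟 φ = 0`, at real points by continuity (`cauchyFueter_laplacian_eq_zero`). Consequently
`𝒟 (x₀ ^ k Δ f_k) = k x₀ ^ (k - 1) Δ f_k`, so that `𝒟 ^ (n - 1)` maps `∑ x₀ ^ k Δ f_k` to
`(n - 1)! Δ f_{n-1}` and `𝒟 ^ n` annihilates it.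

The operators `∂̄_I`, `V` and `𝒟` all act on these sums like a multiple of the derivative on
polynomials; their iterates are treated together in `iterate_eqOn_sum`.
-/

noncomputable section

namespace PolyFueter

open Complex (reCLM imCLM)
open scoped ComplexConjugate ContDiff Topology

/-! ### The planes `ℂ_I` -/

lemma mul_self_of_mem {I : ℍ} (hI : I ∈ imagUnits) : I * I = -1 := by
  have h : I ^ 2 = -1 := hI
  rwa [sq] at h

lemma neg_mem_imagUnits {I : ℍ} (hI : I ∈ imagUnits) : -I ∈ imagUnits := by
  show (-I) ^ 2 = -1
  rw [neg_sq]; exact hI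

lemma re_eq_zero_of_mem {I : ℍ} (hI : I ∈ imagUnits) : I.re = 0 := by
  have h := mul_self_of_mem hI
  have h0 := congrArg (fun q : ℍ => q.re) h
  have h1 := congrArg (fun q : ℍ => q.imI) h
  have h2 := congrArg (fun q : ℍ => q.imJ) h
  have h3 := congrArg (fun q : ℍ => q.imK) h
  simp only [Quaternion.re_mul, Quaternion.imI_mul, Quaternion.imJ_mul, Quaternion.imK_mul,
    Quaternion.re_neg, Quaternion.imI_neg, Quaternion.imJ_neg, Quaternion.imK_neg,
    Quaternion.re_one, Quaternion.imI_one, Quaternion.imJ_one, Quaternion.imK_one] at h0 h1 h2 h3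
  by_contra hne
  have a1 : I.imI = 0 := by
    have : I.re * I.imI = 0 := by linarith
    simpa [hne] using this
  have a2 : I.imJ = 0 := by
    have : I.re * I.imJ = 0 := by linarith
    simpa [hne] using this
  have a3 : I.imK = 0 := by
    have : I.re * I.imK = 0 := by linarith
    simpa [hne] using this
  rw [a1, a2, a3] at h0
  nlinarith [mul_self_nonneg I.re]

lemma norm_of_mem {I : ℍ} (hI : I ∈ imagUnits) : ‖I‖ = 1 := by
  have h : ‖I‖ * ‖I‖ = 1 := by rw [← norm_mul, mul_self_of_mem hI, norm_neg, norm_one]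
  nlinarith [norm_nonneg I]

lemma star_of_mem {I : ℍ} (hI : I ∈ imagUnits) : star I = -I := by
  ext <;> simp [re_eq_zero_of_mem hI]

lemma im_of_mem {I : ℍ} (hI : I ∈ imagUnits) : I.im = I := by
  ext <;> simp [re_eq_zero_of_mem hI]

/-- `slicePt I` as a real linear map. -/
def slicePtL (I : ℍ) : ℂ →L[ℝ] ℍ := reCLM.smulRight 1 + imCLM.smulRight I

lemma slicePtL_apply (I : ℍ) (z : ℂ) : slicePtL I z = slicePt I z := by
  simp only [slicePtL, slicePt, add_apply, ContinuousLinearMap.smulRight_apply,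
    Complex.reCLM_apply, Complex.imCLM_apply]
  rw [Quaternion.mul_coe_eq_smul, ← Quaternion.coe_mul_eq_smul, mul_one]

lemma coe_slicePtL (I : ℍ) : ⇑(slicePtL I) = slicePt I := funext (slicePtL_apply I)

lemma contDiff_slicePt (I : ℍ) {n : WithTop ℕ∞} : ContDiff ℝ n (slicePt I) := by
  rw [← coe_slicePtL]; exact (slicePtL I).contDiff

lemma continuous_slicePt (I : ℍ) : Continuous (slicePt I) :=
  (contDiff_slicePt I (n := 0)).continuous

lemma slicePt_add (I : ℍ) (z w : ℂ) : slicePt I (z + w) = slicePt I z + slicePt I w := by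
  simp only [← slicePtL_apply, map_add]

lemma slicePt_zero (I : ℍ) : slicePt I 0 = 0 := by
  simp only [← slicePtL_apply, map_zero]

lemma slicePt_real (I : ℍ) (x : ℝ) : slicePt I (x : ℂ) = (x : ℍ) := by
  simp [slicePt]

lemma slicePt_one (I : ℍ) : slicePt I 1 = 1 := by
  simp [slicePt]

lemma slicePt_I (I : ℍ) : slicePt I Complex.I = I := by
  simp [slicePt]

lemma slicePt_of_im_eq_zero (I : ℍ) {z : ℂ} (hz : z.im = 0) : slicePt I z = (z.re : ℍ) := by
  simp [slicePt, hz]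

lemma slicePt_mul {I : ℍ} (hI : I ∈ imagUnits) (z w : ℂ) :
    slicePt I (z * w) = slicePt I z * slicePt I w := by
  have key (z : ℂ) : slicePt I z = Complex.liftAux I (mul_self_of_mem hI) z := by
    rw [Complex.liftAux_apply, slicePt, Quaternion.mul_coe_eq_smul]; rfl
  rw [key, key, key, map_mul]

lemma slicePt_pow {I : ℍ} (hI : I ∈ imagUnits) (z : ℂ) (n : ℕ) :
    slicePt I (z ^ n) = slicePt I z ^ n := by
  induction n with
  | zero => simp [slicePt_one]
  | succ n ih => rw [pow_succ, slicePt_mul hI, ih, pow_succ]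

lemma slicePt_conj (I : ℍ) (z : ℂ) : slicePt I (conj z) = slicePt (-I) z := by
  simp [slicePt]

lemma star_slicePt {I : ℍ} (hI : I ∈ imagUnits) (z : ℂ) :
    star (slicePt I z) = slicePt I (conj z) := by
  simp only [slicePt, star_add, star_mul, Quaternion.star_coe, star_of_mem hI, Complex.conj_re,
    Complex.conj_im, Quaternion.coe_neg]
  rw [mul_neg, mul_neg, Quaternion.coe_commutes]

lemma norm_slicePt {I : ℍ} (hI : I ∈ imagUnits) (z : ℂ) : ‖slicePt I z‖ = ‖z‖ := by
  have h : slicePt I z * star (slicePt I z) = ((Complex.normSq z : ℝ) : ℍ) := by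
    rw [star_slicePt hI, ← slicePt_mul hI, Complex.mul_conj, slicePt_real]
  have h2 := congrArg norm h
  rw [norm_mul, norm_star, Quaternion.norm_coe, Real.norm_of_nonneg (Complex.normSq_nonneg z),
    Complex.normSq_eq_norm_sq, ← sq] at h2
  exact (sq_eq_sq₀ (norm_nonneg _) (norm_nonneg _)).1 h2

lemma re_slicePt {I : ℍ} (hI : I ∈ imagUnits) (z : ℂ) : (slicePt I z).re = z.re := by
  rw [slicePt, Quaternion.mul_coe_eq_smul]; simp [re_eq_zero_of_mem hI]

lemma im_slicePt {I : ℍ} (hI : I ∈ imagUnits) (z : ℂ) : (slicePt I z).im = z.im • I := by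
  rw [slicePt, Quaternion.mul_coe_eq_smul]
  ext <;> simp [re_eq_zero_of_mem hI]

lemma im_mul_im (q : ℍ) : q.im * q.im = -((‖q.im‖ ^ 2 : ℝ) : ℍ) := by
  rw [sq, ← Quaternion.normSq_eq_norm_mul_self, ← Quaternion.coe_neg, Quaternion.normSq_def']
  ext <;> simp only [Quaternion.re_mul, Quaternion.imI_mul, Quaternion.imJ_mul, Quaternion.imK_mul,
    Quaternion.re_coe, Quaternion.imI_coe, Quaternion.imJ_coe, Quaternion.imK_coe,
    Quaternion.re_im, Quaternion.imI_im, Quaternion.imJ_im, Quaternion.imK_im] <;> ring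

/-- The point of the closed upper half plane over which `q` lies. -/
def sliceCoord (q : ℍ) : ℂ := ⟨q.re, ‖q.im‖⟩

/-- The imaginary unit `q⃗ / |q⃗|` of the plane `ℂ_I` through `q` (zero if `q` is real). -/
def imDir (q : ℍ) : ℍ := ‖q.im‖⁻¹ • q.im

lemma imDir_mem {q : ℍ} (hq : q ∉ realAxis) : imDir q ∈ imagUnits := by
  have h : ‖q.im‖ ≠ 0 := by simpa [realAxis] using hq
  show _ ^ 2 = _
  rw [imDir, sq, smul_mul_smul_comm, im_mul_im, ← Quaternion.coe_neg, ← Quaternion.coe_smul]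
  rw [← Quaternion.coe_one, ← Quaternion.coe_neg]
  congr 1
  simp only [smul_eq_mul]
  field_simp

lemma slicePt_imDir_sliceCoord (q : ℍ) : slicePt (imDir q) (sliceCoord q) = q := by
  rw [slicePt, Quaternion.mul_coe_eq_smul, sliceCoord, imDir]
  by_cases h : ‖q.im‖ = 0
  · simp only [h, zero_smul, add_zero]
    have : q.im = 0 := by simpa using h
    conv_rhs => rw [← Quaternion.re_add_im q, this, add_zero]
  · rw [smul_smul, mul_inv_cancel₀ h, one_smul]
    exact Quaternion.re_add_im q

@[simp] lemma re_e₁ : e₁.re = 0 := rfl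
@[simp] lemma imI_e₁ : e₁.imI = 1 := rfl
@[simp] lemma imJ_e₁ : e₁.imJ = 0 := rfl
@[simp] lemma imK_e₁ : e₁.imK = 0 := rfl
@[simp] lemma re_e₂ : e₂.re = 0 := rfl
@[simp] lemma imI_e₂ : e₂.imI = 0 := rfl
@[simp] lemma imJ_e₂ : e₂.imJ = 1 := rfl
@[simp] lemma imK_e₂ : e₂.imK = 0 := rfl
@[simp] lemma re_e₃ : e₃.re = 0 := rfl
@[simp] lemma imI_e₃ : e₃.imI = 0 := rfl
@[simp] lemma imJ_e₃ : e₃.imJ = 0 := rfl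
@[simp] lemma imK_e₃ : e₃.imK = 1 := rfl

lemma e₁_mem : e₁ ∈ imagUnits := by
  show _ ^ 2 = _
  rw [sq]; ext <;> simp

lemma e₂_mem : e₂ ∈ imagUnits := by
  show _ ^ 2 = _
  rw [sq]; ext <;> simp

lemma e₃_mem : e₃ ∈ imagUnits := by
  show _ ^ 2 = _
  rw [sq]; ext <;> simp

lemma exists_slicePt (q : ℍ) : ∃ I ∈ imagUnits, slicePt I (sliceCoord q) = q := by
  by_cases hq : q ∈ realAxis
  · refine ⟨e₁, e₁_mem, ?_⟩
    have h : q.im = 0 := hq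
    rw [slicePt_of_im_eq_zero _ (by simp [sliceCoord, h]), sliceCoord]
    conv_rhs => rw [← Quaternion.re_add_im q, h, add_zero]
  · exact ⟨imDir q, imDir_mem hq, slicePt_imDir_sliceCoord q⟩

lemma sliceCoord_slicePt {I : ℍ} (hI : I ∈ imagUnits) (z : ℂ) :
    sliceCoord (slicePt I z) = ⟨z.re, |z.im|⟩ := by
  rw [sliceCoord, re_slicePt hI, im_slicePt hI, norm_smul, norm_of_mem hI, mul_one,
    Real.norm_eq_abs]

lemma imDir_slicePt {I : ℍ} (hI : I ∈ imagUnits) (z : ℂ) :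
    imDir (slicePt I z) = (|z.im|⁻¹ * z.im) • I := by
  rw [imDir, im_slicePt hI, norm_smul, norm_of_mem hI, mul_one, Real.norm_eq_abs, smul_smul]

/-- Left multiplication by `1 - J I` intertwines the embeddings of `ℂ` onto `ℂ_I` and `ℂ_J`;
left multiplication by `1 + J I` does so up to conjugation. -/
lemma one_sub_mul_slicePt {I J : ℍ} (hI : I ∈ imagUnits) (hJ : J ∈ imagUnits) (z : ℂ) :
    (1 - J * I) * slicePt I z = slicePt J z * (1 - J * I) := by
  have h1 : (1 - J * I) * I = J * (1 - J * I) := by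
    rw [sub_mul, mul_sub, mul_assoc, mul_self_of_mem hI, ← mul_assoc, mul_self_of_mem hJ]
    simp [add_comm, sub_eq_add_neg]
  rw [slicePt, slicePt, mul_add, add_mul, ← mul_assoc, h1, mul_assoc J _ (z.im : ℍ),
    ← Quaternion.coe_commutes z.re, ← Quaternion.coe_commutes z.im, mul_assoc]

lemma one_add_mul_slicePt {I J : ℍ} (hI : I ∈ imagUnits) (hJ : J ∈ imagUnits) (z : ℂ) :
    (1 + J * I) * slicePt I z = slicePt J (conj z) * (1 + J * I) := by
  have h := one_sub_mul_slicePt (neg_mem_imagUnits hI) hJ (conj z)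
  rw [← slicePt_conj, Complex.conj_conj] at h
  simpa using h

/-! ### Holomorphic functions for the complex structure of left multiplication by `I` -/

/-- `h` is holomorphic on `U` for the complex structure on `ℍ` given by left multiplication
by `I`. -/
def IsSliceHolo (I : ℍ) (U : Set ℂ) (h : ℂ → ℍ) : Prop :=
  DifferentiableOn ℝ h U ∧ ∀ z ∈ U, dbar I h z = 0

lemma dbar_eq_zero_iff {I : ℍ} (hI : I ∈ imagUnits) {h : ℂ → ℍ} {z : ℂ} :
    dbar I h z = 0 ↔ fderiv ℝ h z Complex.I = I * fderiv ℝ h z 1 := by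
  rw [dbar, smul_eq_zero_iff_right (by norm_num)]
  constructor
  · intro h0
    have h1 := congrArg (fun q => I * q) h0
    simp only [mul_add, ← mul_assoc, mul_self_of_mem hI, mul_zero] at h1
    rw [neg_one_mul, ← sub_eq_add_neg, sub_eq_zero] at h1
    exact h1.symm
  · intro h0
    rw [h0, ← mul_assoc, mul_self_of_mem hI, neg_one_mul, add_neg_cancel]

lemma map_eq_re_add_im (L : ℂ →L[ℝ] ℍ) (w : ℂ) : L w = w.re • L 1 + w.im • L Complex.I := by
  conv_lhs => rw [show w = w.re • (1 : ℂ) + w.im • Complex.I by simp [Complex.re_add_im]]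
  simp only [map_add, map_smul]

lemma fderiv_apply_of_dbar {I : ℍ} (hI : I ∈ imagUnits) {h : ℂ → ℍ} {z : ℂ}
    (hz : dbar I h z = 0) (w : ℂ) : fderiv ℝ h z w = slicePt I w * fderiv ℝ h z 1 := by
  rw [map_eq_re_add_im, (dbar_eq_zero_iff hI).1 hz, slicePt, Quaternion.mul_coe_eq_smul, add_mul,
    Quaternion.coe_mul_eq_smul, smul_mul_assoc]

/-- The complex structure on `ℍ` given by left multiplication by `I`. -/
@[reducible] def sliceNormedSpace {I : ℍ} (hI : I ∈ imagUnits) : NormedSpace ℂ ℍ where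
  smul z q := slicePt I z * q
  one_smul q := by
    show slicePt I 1 * q = q
    rw [slicePt_one, one_mul]
  mul_smul z w q := by
    show slicePt I (z * w) * q = slicePt I z * (slicePt I w * q)
    rw [slicePt_mul hI, mul_assoc]
  smul_zero z := mul_zero _
  smul_add z p q := mul_add _ _ _
  add_smul z w q := by
    show slicePt I (z + w) * q = slicePt I z * q + slicePt I w * q
    rw [slicePt_add, add_mul]
  zero_smul q := by
    show slicePt I 0 * q = 0
    rw [slicePt_zero, zero_mul]
  norm_smul_le z q := by
    show ‖slicePt I z * q‖ ≤ ‖z‖ * ‖q‖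
    rw [norm_mul, norm_slicePt hI]

namespace IsSliceHolo

variable {I : ℍ} {U : Set ℂ} {h : ℂ → ℍ}

lemma analyticOnNhd_complex (hI : I ∈ imagUnits) (hU : IsOpen U) (hh : IsSliceHolo I U h) :
    letI := sliceNormedSpace hI
    AnalyticOnNhd ℂ h U := by
  let := sliceNormedSpace hI
  refine DifferentiableOn.analyticOnNhd (fun z hz => ?_) hU
  have hd := (hh.1.differentiableAt (hU.mem_nhds hz)).hasFDerivAt
  have hc : HasDerivAt h (fderiv ℝ h z 1) z := by
    rw [hasDerivAt_iff_isLittleO]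
    rw [hasFDerivAt_iff_isLittleO] at hd
    refine hd.congr_left fun w => ?_
    rw [fderiv_apply_of_dbar hI (hh.2 z hz)]
    rfl
  exact hc.differentiableAt.differentiableWithinAt

lemma contDiffOn (hI : I ∈ imagUnits) (hU : IsOpen U) (hh : IsSliceHolo I U h) :
    ContDiffOn ℝ ω h U := by
  let := sliceNormedSpace hI
  have : IsScalarTower ℝ ℂ ℍ := ⟨fun x z q => by
    show slicePt I (x • z) * q = x • (slicePt I z * q)
    rw [← slicePtL_apply, map_smul, slicePtL_apply, smul_mul_assoc]⟩
  intro z hz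
  have h1 : AnalyticAt ℝ h z := (hh.analyticOnNhd_complex hI hU z hz).restrictScalars
  exact h1.contDiffAt.contDiffWithinAt

/-- Identity theorem: the real points of a domain are enough to determine `h`. -/
lemma eqOn_zero (hI : I ∈ imagUnits) (hU : IsOpen U) (hconn : IsPreconnected U)
    (hh : IsSliceHolo I U h) {a : ℝ} (ha : (a : ℂ) ∈ U) (h0 : ∀ x : ℝ, (x : ℂ) ∈ U → h x = 0) :
    ∀ z ∈ U, h z = 0 := by
  let := sliceNormedSpace hI
  have han := hh.analyticOnNhd_complex hI hU
  refine han.eqOn_zero_of_preconnected_of_frequently_eq_zero hconn ha ?_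
  have ht : Filter.Tendsto (fun x : ℝ => (x : ℂ)) (𝓝[≠] a) (𝓝[≠] (a : ℂ)) := by
    refine Filter.Tendsto.inf Complex.continuous_ofReal.continuousAt ?_
    simp
  refine ht.frequently (Filter.Eventually.frequently ?_)
  have : ∀ᶠ x : ℝ in 𝓝 a, (x : ℂ) ∈ U :=
    Complex.continuous_ofReal.continuousAt.eventually (hU.mem_nhds ha)
  exact (this.filter_mono nhdsWithin_le_nhds).mono fun x hx => h0 x hx

lemma exists_hasSum (hI : I ∈ imagUnits) (hU : IsOpen U) (hh : IsSliceHolo I U h) {a : ℂ}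
    (ha : a ∈ U) : ∃ (r : NNReal) (c : ℕ → ℍ) (C : ℝ), 0 < r ∧ (∀ n, ‖c n‖ * r ^ n ≤ C) ∧
      ∀ w : ℂ, ‖w‖ < r → HasSum (fun n => slicePt I w ^ n * c n) (h (a + w)) := by
  let := sliceNormedSpace hI
  obtain ⟨p, R, hp⟩ := hh.analyticOnNhd_complex hI hU a ha
  obtain ⟨r, hr0, hrR⟩ := ENNReal.lt_iff_exists_nnreal_btwn.1 hp.r_pos
  obtain ⟨C, -, hC⟩ := p.norm_mul_pow_le_of_lt_radius (hrR.trans_le hp.r_le)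
  refine ⟨r, p.coeff, C, by exact_mod_cast hr0, fun n => ?_, fun w hw => ?_⟩
  · rw [← FormalMultilinearSeries.norm_apply_eq_norm_coef]; exact hC n
  · have hw' : w ∈ Metric.eball (0 : ℂ) R := by
      refine lt_trans ?_ hrR
      rw [edist_zero_right]
      exact_mod_cast hw
    have := hp.hasSum hw'
    refine this.congr_fun fun n => ?_
    rw [FormalMultilinearSeries.apply_eq_pow_smul_coeff, ← slicePt_pow hI]
    rfl

end IsSliceHolo

/-- A convergent power series in a quaternionic variable with coefficients on the right is real
analytic at its centre. -/
lemma analyticAt_of_hasSum_pow {G : ℍ → ℍ} {a : ℍ} {r : NNReal} {c : ℕ → ℍ} {C : ℝ} (hr : 0 < r)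
    (hC : ∀ n, ‖c n‖ * r ^ n ≤ C)
    (hG : ∀ w : ℍ, ‖w‖ < r → HasSum (fun n => w ^ n * c n) (G (a + w))) : AnalyticAt ℝ G a := by
  let p : FormalMultilinearSeries ℝ ℍ ℍ := fun n =>
    ((ContinuousLinearMap.mul ℝ ℍ).flip (c n)).compContinuousMultilinearMap
      (ContinuousMultilinearMap.mkPiAlgebraFin ℝ n ℍ)
  refine ⟨p, r, ?_, by exact_mod_cast hr, fun {w} hw => ?_⟩
  · refine p.le_radius_of_bound C fun n => le_trans ?_ (hC n)
    gcongr
    refine (ContinuousLinearMap.norm_compContinuousMultilinearMap_le _ _).trans ?_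
    rw [ContinuousMultilinearMap.norm_mkPiAlgebraFin, mul_one]
    refine ContinuousLinearMap.opNorm_le_bound _ (norm_nonneg _) fun q => ?_
    rw [ContinuousLinearMap.flip_apply, ContinuousLinearMap.mul_apply', norm_mul, mul_comm]
  · have hw' : ‖w‖ < r := by
      have : edist w 0 < r := hw
      rw [edist_zero_right] at this
      exact_mod_cast this
    refine (hG w hw').congr_fun fun n => ?_
    simp [p, ContinuousMultilinearMap.mkPiAlgebraFin_apply, List.ofFn_const]

/-! ### Calculus of `∂̄_I` -/

lemma dbar_congr {I : ℍ} {F G : ℂ → ℍ} {z : ℂ} (h : F =ᶠ[𝓝 z] G) : dbar I F z = dbar I G z := by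
  rw [dbar, dbar, h.fderiv_eq]

lemma dbar_eqOn {I : ℍ} {F G : ℂ → ℍ} {U : Set ℂ} (hU : IsOpen U) (h : Set.EqOn F G U) :
    Set.EqOn (dbar I F) (dbar I G) U :=
  fun _ hz => dbar_congr (h.eventuallyEq_of_mem (hU.mem_nhds hz))

lemma dbar_sub {I : ℍ} {F G : ℂ → ℍ} {z : ℂ} (hF : DifferentiableAt ℝ F z)
    (hG : DifferentiableAt ℝ G z) :
    dbar I (fun w => F w - G w) z = dbar I F z - dbar I G z := by
  simp only [dbar, fderiv_fun_sub hF hG, sub_apply, mul_sub, ← smul_sub]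
  congr 1; abel

lemma dbar_sum {I : ℍ} {n : ℕ} {F : ℕ → ℂ → ℍ} {z : ℂ} (r : ℕ → ℝ)
    (hF : ∀ k < n, DifferentiableAt ℝ (F k) z) :
    dbar I (fun w => ∑ k ∈ Finset.range n, r k • F k w) z =
      ∑ k ∈ Finset.range n, r k • dbar I (F k) z := by
  have h : ∀ k ∈ Finset.range n, DifferentiableAt ℝ (fun w => r k • F k w) z :=
    fun k hk => (hF k (Finset.mem_range.1 hk)).const_smul (r k)
  have h' : fderiv ℝ (fun w => ∑ k ∈ Finset.range n, r k • F k w) z =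
      ∑ k ∈ Finset.range n, r k • fderiv ℝ (F k) z := by
    rw [fderiv_fun_sum h]
    exact Finset.sum_congr rfl fun k hk => fderiv_fun_const_smul (hF k (Finset.mem_range.1 hk)) _
  simp only [dbar, h', sum_apply, smul_apply, Finset.mul_sum, mul_smul_comm,
    ← Finset.sum_add_distrib, Finset.smul_sum, ← smul_add]
  exact Finset.sum_congr rfl fun k _ => smul_comm _ _ _

/-- `∂̄_I (z̄ ^ k h) = k z̄ ^ (k - 1) h + z̄ ^ k ∂̄_I h`. -/
lemma dbar_pow_mul {I : ℍ} (hI : I ∈ imagUnits) (k : ℕ) {h : ℂ → ℍ} {z : ℂ}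
    (hh : DifferentiableAt ℝ h z) :
    dbar I (fun w => slicePt I (conj w) ^ k * h w) z =
      (k : ℝ) • (slicePt I (conj z) ^ (k - 1) * h z) + slicePt I (conj z) ^ k * dbar I h z := by
  have hP : HasFDerivAt (fun w : ℂ => conj w ^ k)
      (((ContinuousLinearMap.toSpanSingleton ℂ
        ((k : ℂ) * conj z ^ (k - 1))).restrictScalars ℝ).comp
        (Complex.conjCLE : ℂ →L[ℝ] ℂ)) z := by
    have h1 := ((hasDerivAt_pow k (conj z)).hasFDerivAt.restrictScalars ℝ)
    exact h1.comp z Complex.conjCLE.hasFDerivAt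
  have hQ := (slicePtL I).hasFDerivAt.comp z hP
  have hD := (hQ.mul' hh.hasFDerivAt).fderiv
  have hfun : (fun w => slicePt I (conj w) ^ k * h w) =
      (slicePtL I ∘ fun w : ℂ => conj w ^ k) * h := by
    funext w
    simp only [Pi.mul_apply, Function.comp_apply, slicePtL_apply, slicePt_pow hI]
  have hsm : (k : ℝ) • (slicePt I (conj z) ^ (k - 1) * h z) =
      slicePt I ((k : ℂ) * conj z ^ (k - 1)) * h z := by
    rw [slicePt_mul hI, slicePt_pow hI, show (k : ℂ) = ((k : ℝ) : ℂ) by simp, slicePt_real,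
      Quaternion.coe_mul_eq_smul, smul_mul_assoc]
  rw [hsm, hfun, dbar, hD]
  simp only [add_apply, smul_apply, op_smul_eq_mul, smul_eq_mul,
    ContinuousLinearMap.comp_apply, slicePtL_apply, Function.comp_apply,
    ContinuousLinearMap.coe_restrictScalars', ContinuousLinearMap.toSpanSingleton_apply,
    ContinuousLinearEquiv.coe_coe, Complex.conjCLE_apply, map_one, one_mul, Complex.conj_I]
  set A := (k : ℂ) * conj z ^ (k - 1)
  have hIA : I * slicePt I (-Complex.I * A) = slicePt I A := by
    rw [neg_mul, ← slicePtL_apply, map_neg, slicePtL_apply, slicePt_mul hI, slicePt_I, mul_neg,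
      ← mul_assoc, mul_self_of_mem hI, neg_one_mul, neg_neg]
  have hIP : I * slicePt I (conj z ^ k) = slicePt I (conj z ^ k) * I := by
    have h1 := slicePt_mul hI Complex.I (conj z ^ k)
    rwa [mul_comm, slicePt_mul hI, slicePt_I, eq_comm] at h1
  rw [mul_add, ← mul_assoc, hIP, ← mul_assoc, hIA, dbar, ← slicePt_pow hI, mul_smul_comm, mul_add,
    mul_assoc]
  rw [show ∀ a b c : ℍ, (b + a) + (c + a) = (2 : ℝ) • a + (b + c) by
    intro a b c; rw [two_smul]; abel, smul_add, smul_smul]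
  norm_num

/-- If an operator acts on the terms `b j k` (the `k`-th coefficient times a `j`-th power) like `c`
times the derivative acts on the powers, then its iterates act like those of the derivative. The
sums are kept whole, so that `T` need not be linear. -/
lemma iterate_eqOn_sum {X : Type*} {U : Set X} {T : (X → ℍ) → X → ℍ}
    (hcongr : ∀ F G : X → ℍ, Set.EqOn F G U → Set.EqOn (T F) (T G) U)
    {n : ℕ} {c : ℝ} {b : ℕ → ℕ → X → ℍ}
    (hT : ∀ (r : ℕ → ℝ) (j : ℕ → ℕ), Set.EqOn (T fun x => ∑ k ∈ Finset.range n, r k • b (j k) k x)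
      (fun x => ∑ k ∈ Finset.range n, (r k * (c * j k)) • b (j k - 1) k x) U)
    {F : X → ℍ} (hF : Set.EqOn F (fun x => ∑ k ∈ Finset.range n, b k k x) U) (m : ℕ) :
    Set.EqOn (T^[m] F) (fun x => ∑ k ∈ Finset.range n,
      (c ^ m * k.descFactorial m : ℝ) • b (k - m) k x) U := by
  induction m with
  | zero => simpa using hF
  | succ m ih =>
    rw [Function.iterate_succ_apply']
    refine (hcongr _ _ ih).trans ((hT _ _).trans fun x _ => Finset.sum_congr rfl fun k _ => ?_)
    rw [Nat.descFactorial_succ, Nat.sub_sub]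
    congr 1
    push_cast
    ring

/-- In a sum as in `iterate_eqOn_sum`, only the top term survives `n - 1` steps. -/
lemma sum_descFactorial_pred {n : ℕ} (hn : 1 ≤ n) (c : ℝ) (b : ℕ → ℕ → ℍ) :
    ∑ k ∈ Finset.range n, (c * k.descFactorial (n - 1) : ℝ) • b (k - (n - 1)) k =
      (c * (n - 1).factorial : ℝ) • b 0 (n - 1) := by
  rw [Finset.sum_eq_single_of_mem (n - 1) (Finset.mem_range.2 (by omega))]
  · rw [Nat.descFactorial_self, Nat.sub_self]
  · intro k hk hne
    rw [Finset.mem_range] at hk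
    rw [Nat.descFactorial_of_lt (by omega)]
    simp

lemma sum_descFactorial_self (n : ℕ) (c : ℝ) (b : ℕ → ℕ → ℍ) :
    ∑ k ∈ Finset.range n, (c * k.descFactorial n : ℝ) • b (k - n) k = 0 :=
  Finset.sum_eq_zero fun k hk => by
    rw [Nat.descFactorial_of_lt (Finset.mem_range.1 hk)]; simp

lemma IsSliceHolo.differentiableAt {I : ℍ} {U : Set ℂ} {h : ℂ → ℍ} (hU : IsOpen U)
    (hh : IsSliceHolo I U h) {z : ℂ} (hz : z ∈ U) : DifferentiableAt ℝ h z :=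
  hh.1.differentiableAt (hU.mem_nhds hz)

lemma differentiableAt_barPow_mul {I : ℍ} (k : ℕ) {h : ℂ → ℍ} {z : ℂ}
    (hh : DifferentiableAt ℝ h z) :
    DifferentiableAt ℝ (fun w => slicePt I (conj w) ^ k * h w) z := by
  have h1 : Differentiable ℝ (slicePt I) := (contDiff_slicePt I (n := 1)).differentiable (by simp)
  have h2 : Differentiable ℝ fun w : ℂ => slicePt I (conj w) :=
    h1.comp Complex.conjCLE.differentiable
  exact ((h2 z).pow k).mul hh

lemma dbar_sum_pow {I : ℍ} (hI : I ∈ imagUnits) {U : Set ℂ} (hU : IsOpen U) {n : ℕ}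
    {h : ℕ → ℂ → ℍ} (hh : ∀ k < n, IsSliceHolo I U (h k)) (r : ℕ → ℝ) (j : ℕ → ℕ) :
    Set.EqOn (dbar I fun z => ∑ k ∈ Finset.range n, r k • (slicePt I (conj z) ^ j k * h k z))
      (fun z => ∑ k ∈ Finset.range n,
        (r k * (1 * j k)) • (slicePt I (conj z) ^ (j k - 1) * h k z)) U := by
  intro z hz
  dsimp only
  rw [dbar_sum (F := fun k z => slicePt I (conj z) ^ j k * h k z) r fun k hk =>
    differentiableAt_barPow_mul _ ((hh k hk).differentiableAt hU hz)]
  refine Finset.sum_congr rfl fun k hk => ?_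
  have hk' := Finset.mem_range.1 hk
  rw [dbar_pow_mul hI _ ((hh k hk').differentiableAt hU hz), (hh k hk').2 z hz, mul_zero, add_zero,
    smul_smul, one_mul]

lemma dbar_iterate_sum_pow {I : ℍ} (hI : I ∈ imagUnits) {U : Set ℂ} (hU : IsOpen U) {n : ℕ}
    {h : ℕ → ℂ → ℍ} (hh : ∀ k < n, IsSliceHolo I U (h k)) {F : ℂ → ℍ}
    (hF : ∀ z ∈ U, F z = ∑ k ∈ Finset.range n, slicePt I (conj z) ^ k * h k z) (m : ℕ) :
    ∀ z ∈ U, (dbar I)^[m] F z = ∑ k ∈ Finset.range n,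
      (1 ^ m * k.descFactorial m : ℝ) • (slicePt I (conj z) ^ (k - m) * h k z) :=
  iterate_eqOn_sum (T := dbar I) (b := fun j k z => slicePt I (conj z) ^ j * h k z)
    (fun _ _ => dbar_eqOn hU) (dbar_sum_pow hI hU hh) hF m

/-- Uniqueness of the coefficients of a polyanalytic function. -/
lemma eq_zero_of_sum_barPow {I : ℍ} (hI : I ∈ imagUnits) {U : Set ℂ} (hU : IsOpen U) {n : ℕ}
    {h : ℕ → ℂ → ℍ} (hh : ∀ k < n, IsSliceHolo I U (h k))
    (h0 : ∀ z ∈ U, ∑ k ∈ Finset.range n, slicePt I (conj z) ^ k * h k z = 0) :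
    ∀ k < n, ∀ z ∈ U, h k z = 0 := by
  induction n with
  | zero => intro k hk; omega
  | succ n ih =>
    -- `∂̄_I ^ n` isolates the top coefficient
    have top : ∀ z ∈ U, h n z = 0 := by
      intro z hz
      have h1 := dbar_iterate_sum_pow hI hU hh (F := fun _ => 0)
        (fun z hz => (h0 z hz).symm) n z hz
      have h2 := sum_descFactorial_pred (n := n + 1) (by omega) (1 ^ n)
        fun j k => slicePt I (conj z) ^ j * h k z
      rw [Nat.add_sub_cancel] at h2
      rw [h2, pow_zero, one_mul] at h1
      have h3 : (dbar I)^[n] (fun _ => (0 : ℍ)) z = 0 := by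
        have : dbar I (fun _ => (0 : ℍ)) = fun _ => 0 := by
          funext w; simp [dbar]
        rw [Function.iterate_fixed this]
      rw [h3] at h1
      have hne : (1 ^ n * n.factorial : ℝ) ≠ 0 := by positivity
      exact (smul_eq_zero_iff_right hne).1 h1.symm
    intro k hk
    rcases Nat.lt_succ_iff_lt_or_eq.1 hk with hk | rfl
    · refine ih (fun k hk => hh k (by omega)) (fun z hz => ?_) k hk
      have := h0 z hz
      rwa [Finset.sum_range_succ, top z hz, mul_zero, add_zero] at this
    · exact top

lemma contDiffOn_dbar {I : ℍ} {U : Set ℂ} (hU : IsOpen U) {F : ℂ → ℍ} {n : ℕ}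
    (hF : ContDiffOn ℝ (n + 1 : ℕ) F U) : ContDiffOn ℝ n (dbar I F) U := by
  have h1 : ContDiffOn ℝ n (fderiv ℝ F) U :=
    ((contDiffOn_succ_iff_fderiv_of_isOpen hU).1 (by exact_mod_cast hF)).2.2
  have h2 (v : ℂ) : ContDiffOn ℝ n (fun z => fderiv ℝ F z v) U := h1.clm_apply contDiffOn_const
  exact ((h2 1).add (contDiffOn_const.mul (h2 Complex.I))).const_smul (1 / 2 : ℝ)

/-- Polyanalytic functions of one complex variable are polynomials in `z̄` with holomorphic
coefficients: if `∂̄_I F` has coefficients `h k`, then `F` minus the primitive with coefficients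
`h k / (k + 1)` is holomorphic. -/
lemma exists_sum_barPow {I : ℍ} (hI : I ∈ imagUnits) {U : Set ℂ} (hU : IsOpen U) (n : ℕ) :
    ∀ {F : ℂ → ℍ}, ContDiffOn ℝ n F U → (∀ z ∈ U, (dbar I)^[n] F z = 0) →
    ∃ h : ℕ → ℂ → ℍ, (∀ k < n, IsSliceHolo I U (h k)) ∧
      ∀ z ∈ U, F z = ∑ k ∈ Finset.range n, slicePt I (conj z) ^ k * h k z := by
  induction n with
  | zero => exact fun _ h0 => ⟨fun _ _ => 0, by simp, by simpa using h0⟩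
  | succ n ih =>
    intro F hF h0
    obtain ⟨h, hh, hsum⟩ := ih (contDiffOn_dbar hU hF) h0
    have hFd : ∀ z ∈ U, DifferentiableAt ℝ F z := fun z hz =>
      ((hF.differentiableOn (by simp)).differentiableAt (hU.mem_nhds hz))
    -- the termwise primitive of `∂̄_I F` with respect to `z̄`
    let S : ℂ → ℍ := fun z => ∑ k ∈ Finset.range n,
      ((k : ℝ) + 1)⁻¹ • (slicePt I (conj z) ^ (k + 1) * h k z)
    have hSd : ∀ z ∈ U, DifferentiableAt ℝ S z := fun z hz =>
      DifferentiableAt.fun_sum fun k hk => (differentiableAt_barPow_mul _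
        ((hh k (Finset.mem_range.1 hk)).differentiableAt hU hz)).fun_const_smul _
    have hS : ∀ z ∈ U, dbar I S z = dbar I F z := by
      intro z hz
      rw [dbar_sum_pow hI hU hh (fun k => ((k : ℝ) + 1)⁻¹) (fun k => k + 1) hz, hsum z hz]
      refine Finset.sum_congr rfl fun k _ => ?_
      have : (k : ℝ) + 1 ≠ 0 := by positivity
      push_cast
      rw [one_mul, inv_mul_cancel₀ this, one_smul]
    refine ⟨fun k => match k with
      | 0 => fun z => F z - S z
      | k + 1 => fun z => ((k : ℝ) + 1)⁻¹ • h k z, fun k hk => ?_, fun z hz => ?_⟩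
    · match k with
      | 0 =>
        refine ⟨fun z hz => ((hFd z hz).sub (hSd z hz)).differentiableWithinAt, fun z hz => ?_⟩
        dsimp only
        rw [dbar_sub (hFd z hz) (hSd z hz), hS z hz, sub_self]
      | k + 1 =>
        have hk' : k < n := by omega
        refine ⟨(hh k hk').1.fun_const_smul _, fun z hz => ?_⟩
        have h1 := (hh k hk').2 z hz
        rw [dbar_eq_zero_iff hI] at h1 ⊢
        dsimp only
        rw [fderiv_fun_const_smul ((hh k hk').differentiableAt hU hz), smul_apply, smul_apply, h1,
          mul_smul_comm]
    · rw [Finset.sum_range_succ']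
      simp only [pow_zero, one_mul, mul_smul_comm]
      exact (add_sub_cancel (S z) (F z)).symm

/-! ### The representation formula -/

section

/-- With `z = x + i y`, the value at `x + J y` of the slice function that is `h z` at `x + I y`. -/
def sliceFormula (I J : ℍ) (h : ℂ → ℍ) (z : ℂ) : ℍ :=
  (1 / 2 : ℝ) • ((1 - J * I) * h z + (1 + J * I) * h (conj z))

/-- The component `α` of the slice function `α + J β` whose restriction to one slice is `h`. -/
def evenPart (h : ℂ → ℍ) (z : ℂ) : ℍ := (1 / 2 : ℝ) • (h z + h (conj z))

/-- The component `β` of the slice function `α + J β` whose restriction to `ℂ_I` is `h`. -/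
def oddPart (I : ℍ) (h : ℂ → ℍ) (z : ℂ) : ℍ := (1 / 2 : ℝ) • (I * (h (conj z) - h z))

lemma sliceFormula_eq_evenPart_add (I J : ℍ) (h : ℂ → ℍ) (z : ℂ) :
    sliceFormula I J h z = evenPart h z + J * oddPart I h z := by
  rw [sliceFormula, evenPart, oddPart, mul_smul_comm, ← smul_add]
  congr 1
  noncomm_ring

/-- `φ` is given on `Ω` by the representation formula from the function `h` on the slice `Ω_I`. -/
def IsSliceExt (Ω : Set ℍ) (I : ℍ) (h : ℂ → ℍ) (φ : ℍ → ℍ) : Prop :=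
  ∀ J ∈ imagUnits, ∀ z : ℂ, slicePt J z ∈ Ω → φ (slicePt J z) = sliceFormula I J h z

lemma sliceFormula_neg (I J : ℍ) (h : ℂ → ℍ) (z : ℂ) :
    sliceFormula I (-J) h (conj z) = sliceFormula I J h z := by
  simp [sliceFormula, add_comm, sub_eq_add_neg]

lemma sliceFormula_of_im_eq_zero (I J : ℍ) (h : ℂ → ℍ) {z : ℂ} (hz : z.im = 0) :
    sliceFormula I J h z = h z := by
  have : conj z = z := Complex.conj_eq_iff_im.2 hz
  rw [sliceFormula, this, ← add_mul, sub_add_add_cancel, add_mul, one_mul, smul_add, ← add_smul]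
  norm_num

lemma IsSliceExt.apply {Ω : Set ℍ} {I : ℍ} {h : ℂ → ℍ} {φ : ℍ → ℍ} (hφ : IsSliceExt Ω I h φ)
    {q : ℍ} (hq : q ∈ Ω) : φ q = sliceFormula I (imDir q) h (sliceCoord q) := by
  by_cases hr : q ∈ realAxis
  · obtain ⟨J, hJ, hJq⟩ := exists_slicePt q
    have him : (sliceCoord q).im = 0 := by
      have : q.im = 0 := hr
      simp [sliceCoord, this]
    rw [← hJq] at hq
    conv_lhs => rw [← hJq]
    rw [hφ J hJ _ hq, sliceFormula_of_im_eq_zero _ _ _ him, sliceFormula_of_im_eq_zero _ _ _ him]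
  · have h1 := hφ _ (imDir_mem hr) (sliceCoord q)
    rw [slicePt_imDir_sliceCoord] at h1
    exact h1 hq

lemma isSliceExt_sliceFormula (Ω : Set ℍ) (I : ℍ) (h : ℂ → ℍ) :
    IsSliceExt Ω I h fun q => sliceFormula I (imDir q) h (sliceCoord q) := by
  intro J hJ z _
  dsimp only
  rw [sliceCoord_slicePt hJ, imDir_slicePt hJ]
  rcases lt_trichotomy z.im 0 with hz | hz | hz
  · rw [abs_of_neg hz, inv_neg, neg_mul, inv_mul_cancel₀ hz.ne, neg_one_smul]
    exact sliceFormula_neg I J h z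
  · have : (⟨z.re, |z.im|⟩ : ℂ) = z := by rw [hz, abs_zero, ← hz]
    rw [this, sliceFormula_of_im_eq_zero _ _ _ hz, sliceFormula_of_im_eq_zero _ _ _ hz]
  · rw [abs_of_pos hz, inv_mul_cancel₀ hz.ne', one_smul]

/-- Multiplication by `q̄ ^ k` commutes with the representation formula. -/
lemma sliceFormula_barPow_mul {I J : ℍ} (hI : I ∈ imagUnits) (hJ : J ∈ imagUnits) (k : ℕ)
    (h : ℂ → ℍ) (z : ℂ) :
    sliceFormula I J (fun w => slicePt I (conj w) ^ k * h w) z =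
      slicePt J (conj z) ^ k * sliceFormula I J h z := by
  have e1 := one_sub_mul_slicePt hI hJ (conj z ^ k)
  have e2 := one_add_mul_slicePt hI hJ (z ^ k)
  simp only [sliceFormula, ← slicePt_pow hI, ← slicePt_pow hJ, Complex.conj_conj]
  rw [map_pow] at e2
  generalize 1 - J * I = A at *
  generalize 1 + J * I = B at *
  rw [mul_smul_comm, mul_add, ← mul_assoc, ← mul_assoc, e1, e2, mul_assoc, mul_assoc]

lemma sliceFormula_sum (I J : ℍ) {n : ℕ} (h : ℕ → ℂ → ℍ) (z : ℂ) :
    sliceFormula I J (fun w => ∑ k ∈ Finset.range n, h k w) z =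
      ∑ k ∈ Finset.range n, sliceFormula I J (h k) z := by
  simp only [sliceFormula, Finset.mul_sum, ← Finset.sum_add_distrib, Finset.smul_sum]

namespace IsAxSymSliceDomain

variable {Ω : Set ℍ}

lemma isOpen_preimage (hΩ : IsAxSymSliceDomain Ω) (I : ℍ) : IsOpen (slicePt I ⁻¹' Ω) :=
  hΩ.isOpen.preimage (continuous_slicePt I)

lemma preimage_eq (hΩ : IsAxSymSliceDomain Ω) {I J : ℍ} (hI : I ∈ imagUnits)
    (hJ : J ∈ imagUnits) : slicePt I ⁻¹' Ω = slicePt J ⁻¹' Ω :=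
  Set.ext fun z => ⟨hΩ.axially_symmetric I hI J hJ z, hΩ.axially_symmetric J hJ I hI z⟩

lemma conj_mem (hΩ : IsAxSymSliceDomain Ω) {I : ℍ} (hI : I ∈ imagUnits) {z : ℂ}
    (hz : z ∈ slicePt I ⁻¹' Ω) : conj z ∈ slicePt I ⁻¹' Ω := by
  rw [Set.mem_preimage, slicePt_conj]
  exact hΩ.axially_symmetric I hI (-I) (neg_mem_imagUnits hI) z hz

lemma sliceCoord_mem (hΩ : IsAxSymSliceDomain Ω) {I : ℍ} (hI : I ∈ imagUnits) {q : ℍ}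
    (hq : q ∈ Ω) : sliceCoord q ∈ slicePt I ⁻¹' Ω := by
  obtain ⟨J, hJ, hJq⟩ := exists_slicePt q
  exact hΩ.axially_symmetric J hJ I hI _ (by rwa [hJq])

lemma exists_real_mem (hΩ : IsAxSymSliceDomain Ω) : ∃ a : ℝ, (a : ℍ) ∈ Ω := by
  obtain ⟨q, hq, hr⟩ := hΩ.inter_real
  refine ⟨q.re, ?_⟩
  have : q.im = 0 := hr
  rw [← Quaternion.re_add_im q, this, add_zero] at hq
  exact hq

end IsAxSymSliceDomain

lemma hasFDerivAt_sliceFormula (I J : ℍ) {h : ℂ → ℍ} {z : ℂ} (hz : DifferentiableAt ℝ h z)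
    (hz' : DifferentiableAt ℝ h (conj z)) :
    HasFDerivAt (sliceFormula I J h)
      ((1 / 2 : ℝ) • ((1 - J * I) • fderiv ℝ h z +
        (1 + J * I) • (fderiv ℝ h (conj z)).comp (Complex.conjCLE : ℂ →L[ℝ] ℂ))) z := by
  have h2 : HasFDerivAt (fun w => h (conj w))
      ((fderiv ℝ h (conj z)).comp (Complex.conjCLE : ℂ →L[ℝ] ℂ)) z :=
    hz'.hasFDerivAt.comp z Complex.conjCLE.hasFDerivAt
  exact ((hz.hasFDerivAt.const_mul _).add (h2.const_mul _)).const_smul (1 / 2 : ℝ)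

/-- The representation formula turns `I`-holomorphic functions into `J`-holomorphic ones. -/
lemma IsSliceHolo.sliceFormula {I J : ℍ} (hI : I ∈ imagUnits) (hJ : J ∈ imagUnits) {U : Set ℂ}
    (hU : IsOpen U) (hconj : ∀ z ∈ U, conj z ∈ U) {h : ℂ → ℍ} (hh : IsSliceHolo I U h) :
    IsSliceHolo J U (sliceFormula I J h) := by
  have key : ∀ z ∈ U, _ := fun z hz => hasFDerivAt_sliceFormula I J
    (hh.differentiableAt hU hz) (hh.differentiableAt hU (hconj z hz))
  refine ⟨fun z hz => (key z hz).differentiableAt.differentiableWithinAt, fun z hz => ?_⟩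
  rw [dbar_eq_zero_iff hJ, (key z hz).fderiv]
  have h1 := (dbar_eq_zero_iff hI).1 (hh.2 z hz)
  have h2 := (dbar_eq_zero_iff hI).1 (hh.2 _ (hconj z hz))
  simp only [smul_apply, add_apply, ContinuousLinearMap.comp_apply, ContinuousLinearEquiv.coe_coe,
    Complex.conjCLE_apply, Complex.conj_I, map_neg, map_one, h1, h2, smul_eq_mul, mul_smul_comm]
  congr 1
  have e1 := one_sub_mul_slicePt hI hJ Complex.I
  have e2 := one_add_mul_slicePt hI hJ Complex.I
  rw [Complex.conj_I, ← slicePtL_apply J, map_neg, slicePtL_apply, slicePt_I, slicePt_I] at e2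
  rw [slicePt_I, slicePt_I] at e1
  rw [mul_neg, ← mul_assoc, ← mul_assoc, e1, e2, mul_add J (_ * _) (_ * _), mul_assoc,
    mul_assoc (-J), neg_mul, neg_neg]

variable {Ω : Set ℍ} {I : ℍ} {h : ℂ → ℍ} {φ : ℍ → ℍ}

lemma IsSliceExt.isSliceFunction (hφ : IsSliceExt Ω I h φ) :
    IsSliceFunction Ω φ := by
  refine ⟨fun x y => evenPart h ⟨x, y⟩, fun x y => oddPart I h ⟨x, y⟩, fun x y => ?_, fun x y => ?_,
    fun J hJ z hz => (hφ J hJ z hz).trans (sliceFormula_eq_evenPart_add I J h z)⟩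
  · have h1 : conj (⟨x, y⟩ : ℂ) = ⟨x, -y⟩ := rfl
    dsimp only
    rw [evenPart, evenPart, ← h1, Complex.conj_conj, add_comm]
  · have h1 : conj (⟨x, y⟩ : ℂ) = ⟨x, -y⟩ := rfl
    dsimp only
    rw [oddPart, oddPart, ← h1, Complex.conj_conj, ← smul_neg, ← mul_neg, neg_sub]

/-- A slice function satisfies the representation formula. -/
lemma IsSliceFunction.isSliceExt (hΩ : IsAxSymSliceDomain Ω) (hI : I ∈ imagUnits)
    (hφ : IsSliceFunction Ω φ) : IsSliceExt Ω I (φ ∘ slicePt I) φ := by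
  obtain ⟨α, β, hα, hβ, hs⟩ := hφ
  intro J hJ z hz
  have hz1 : slicePt I z ∈ Ω := hΩ.axially_symmetric J hJ I hI z hz
  have hz2 : slicePt I (conj z) ∈ Ω := hΩ.conj_mem hI hz1
  rw [sliceFormula, Function.comp_apply, Function.comp_apply, hs I hI z hz1, hs I hI _ hz2,
    hs J hJ z hz, Complex.conj_re, Complex.conj_im, hα, hβ]
  have e : (1 - J * I) * (α z.re z.im + I * β z.re z.im) +
      (1 + J * I) * (α z.re z.im + I * -β z.re z.im) =
      (2 : ℝ) • (α z.re z.im) - (2 : ℝ) • (J * (I * I) * β z.re z.im) := by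
    simp only [two_smul]
    noncomm_ring
  rw [e, mul_self_of_mem hI, smul_sub, smul_smul, smul_smul]
  norm_num

lemma IsSliceHyperholomorphic.isSliceHolo (hΩ : IsAxSymSliceDomain Ω) (hI : I ∈ imagUnits)
    (hφ : IsSliceHyperholomorphic Ω φ) : IsSliceHolo I (slicePt I ⁻¹' Ω) (φ ∘ slicePt I) := by
  refine ⟨fun z hz => ?_, hφ.2 I hI⟩
  have h1 : DifferentiableAt ℝ φ (slicePt I z) :=
    (hφ.1.differentiableOn one_ne_zero).differentiableAt (hΩ.isOpen.mem_nhds hz)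
  have h2 := (contDiff_slicePt I (n := 1)).differentiable one_ne_zero z
  exact (h1.comp z h2).differentiableWithinAt

/-- The representation formula for slice hyperholomorphic functions: the two sides are
`J`-holomorphic and agree at the real points. -/
lemma IsSliceHyperholomorphic.isSliceExt (hΩ : IsAxSymSliceDomain Ω) (hI : I ∈ imagUnits)
    (hφ : IsSliceHyperholomorphic Ω φ) : IsSliceExt Ω I (φ ∘ slicePt I) φ := by
  intro J hJ z hz
  have hU := hΩ.isOpen_preimage J
  have h1 := hφ.isSliceHolo hΩ hJ
  have h2 : IsSliceHolo J (slicePt J ⁻¹' Ω) (sliceFormula I J (φ ∘ slicePt I)) := by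
    refine IsSliceHolo.sliceFormula hI hJ hU (fun z hz => hΩ.conj_mem hJ hz) ?_
    rw [hΩ.preimage_eq hJ hI]
    exact hφ.isSliceHolo hΩ hI
  have h3 : IsSliceHolo J (slicePt J ⁻¹' Ω)
      fun z => (φ ∘ slicePt J) z - sliceFormula I J (φ ∘ slicePt I) z := by
    refine ⟨h1.1.sub h2.1, fun z hz => ?_⟩
    rw [dbar_sub (h1.differentiableAt hU hz) (h2.differentiableAt hU hz), h1.2 z hz, h2.2 z hz,
      sub_zero]
  obtain ⟨a, ha⟩ := hΩ.exists_real_mem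
  have h4 := h3.eqOn_zero hJ hU (hΩ.slice_connected J hJ).isPreconnected (a := a)
    (by rwa [Set.mem_preimage, slicePt_real]) (fun x _ => by
      rw [sliceFormula_of_im_eq_zero _ _ _ (Complex.ofReal_im x), Function.comp_apply,
        Function.comp_apply, slicePt_real, slicePt_real, sub_self]) z hz
  exact sub_eq_zero.1 h4

/-- The real part as a continuous linear map. -/
def reL : ℍ →L[ℝ] ℝ := innerSL ℝ (1 : ℍ)

lemma reL_apply (q : ℍ) : reL q = q.re := by
  simp [reL, Quaternion.inner_def]

/-- The imaginary part as a continuous linear map. -/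
def imL : ℍ →L[ℝ] ℍ := ContinuousLinearMap.id ℝ ℍ - reL.smulRight 1

lemma imL_apply (q : ℍ) : imL q = q.im := by
  ext <;> simp [imL, reL_apply]

lemma coe_reL : ⇑reL = fun q : ℍ => q.re := funext reL_apply

lemma coe_imL : ⇑imL = fun q : ℍ => q.im := funext imL_apply

lemma contDiffAt_sliceCoord {q : ℍ} (hq : q ∉ realAxis) : ContDiffAt ℝ ω sliceCoord q := by
  have hre : ContDiff ℝ ω fun q : ℍ => q.re := coe_reL ▸ reL.contDiff
  have him : ContDiff ℝ ω fun q : ℍ => q.im := coe_imL ▸ imL.contDiff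
  have hn : ContDiffAt ℝ ω (fun q : ℍ => ‖q.im‖) q := him.contDiffAt.norm ℝ hq
  have : sliceCoord = fun q : ℍ => q.re • (1 : ℂ) + ‖q.im‖ • Complex.I := by
    funext q; apply Complex.ext <;> simp [sliceCoord]
  rw [this]
  exact (hre.contDiffAt.smul contDiffAt_const).add (hn.smul contDiffAt_const)

lemma contDiffAt_imDir {q : ℍ} (hq : q ∉ realAxis) : ContDiffAt ℝ ω imDir q := by
  have him : ContDiff ℝ ω fun q : ℍ => q.im := coe_imL ▸ imL.contDiff
  have hn : ContDiffAt ℝ ω (fun q : ℍ => ‖q.im‖) q := him.contDiffAt.norm ℝ hq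
  exact (hn.inv (by simpa [realAxis] using hq)).smul him.contDiffAt

/-- Slice hyperholomorphic functions are real analytic: off the real axis by the representation
formula, and at a real point `a` because they are given by a power series in `q - a`. -/
lemma IsSliceExt.contDiffOn (hΩ : IsAxSymSliceDomain Ω) (hI : I ∈ imagUnits)
    (hh : IsSliceHolo I (slicePt I ⁻¹' Ω) h) (hφ : IsSliceExt Ω I h φ) : ContDiffOn ℝ ω φ Ω := by
  intro q hq
  refine ContDiffAt.contDiffWithinAt ?_
  have hU := hΩ.isOpen_preimage I
  by_cases hr : q ∈ realAxis
  · have him : q.im = 0 := hr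
    have hqa : q = (q.re : ℍ) := by
      conv_lhs => rw [← Quaternion.re_add_im q, him, add_zero]
    set a : ℝ := q.re
    have haU : (a : ℂ) ∈ slicePt I ⁻¹' Ω := by
      rw [Set.mem_preimage, slicePt_real, ← hqa]; exact hq
    obtain ⟨r, c, C, hr0, hC, hs⟩ := hh.exists_hasSum hI hU haU
    obtain ⟨ε, hε, hball⟩ := Metric.isOpen_iff.1 hΩ.isOpen q hq
    -- the expansions at `z` and `z̄` combine, since `½ ((1 - J I) + (1 + J I)) = 1`
    have hG : ∀ w : ℍ, ‖w‖ < (min r ε.toNNReal : NNReal) →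
        HasSum (fun n => w ^ n * c n) (φ (q + w)) := by
      intro w hw
      have hw1 : ‖w‖ < r := hw.trans_le (by exact_mod_cast min_le_left _ _)
      have hw2 : ‖w‖ < ε := by
        have : ((min r ε.toNNReal : NNReal) : ℝ) ≤ ε.toNNReal := by exact_mod_cast min_le_right _ _
        rw [Real.coe_toNNReal ε hε.le] at this
        exact hw.trans_le this
      have hmem : q + w ∈ Ω := hball (by simpa [Metric.mem_ball] using hw2)
      obtain ⟨J, hJ, hJw⟩ := exists_slicePt w
      set z := sliceCoord w
      have hzn : ‖z‖ < r := by rw [← norm_slicePt hJ z, hJw]; exact hw1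
      have hqw : q + w = slicePt J (a + z) := by rw [slicePt_add, slicePt_real, hJw, ← hqa]
      have h1 := hs z hzn
      have h2 := hs (conj z) (by rwa [RCLike.norm_conj])
      have h3 := (((h1.mul_left (1 - J * I)).add (h2.mul_left (1 + J * I))).const_smul (1 / 2 : ℝ))
      rw [hqw] at hmem ⊢
      rw [hφ J hJ _ hmem, sliceFormula, map_add, Complex.conj_ofReal]
      refine h3.congr_fun fun n => ?_
      rw [← slicePt_pow hI, ← slicePt_pow hI, ← mul_assoc, ← mul_assoc, one_sub_mul_slicePt hI hJ,
        one_add_mul_slicePt hI hJ, ← map_pow, Complex.conj_conj, slicePt_pow hJ, hJw, mul_assoc,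
        mul_assoc, ← mul_add, ← add_mul, sub_add_add_cancel, add_mul, one_mul, mul_add, smul_add,
        ← add_smul]
      norm_num
    refine (analyticAt_of_hasSum_pow (C := C) (lt_min hr0 (Real.toNNReal_pos.2 hε))
      (fun n => le_trans ?_ (hC n)) hG).contDiffAt
    gcongr
    exact min_le_left _ _
  · have hc : ContDiffOn ℝ ω h (slicePt I ⁻¹' Ω) := hh.contDiffOn hI hU
    have hz := hΩ.sliceCoord_mem hI hq
    have h1 : ContDiffAt ℝ ω (fun p => h (sliceCoord p)) q :=
      (hc.contDiffAt (hU.mem_nhds hz)).comp q (contDiffAt_sliceCoord hr)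
    have h2 : ContDiffAt ℝ ω (fun p => h (conj (sliceCoord p))) q := by
      refine ContDiffAt.comp q (g := h) (f := fun p => conj (sliceCoord p))
        (hc.contDiffAt (hU.mem_nhds (hΩ.conj_mem hI hz))) ?_
      exact Complex.conjCLE.contDiff.contDiffAt.comp q (contDiffAt_sliceCoord hr)
    have h3 : ContDiffAt ℝ ω (fun p => imDir p * I) q := (contDiffAt_imDir hr).mul contDiffAt_const
    have h4 : ContDiffAt ℝ ω
        (fun p => sliceFormula I (imDir p) h (sliceCoord p)) q :=
      (((contDiffAt_const.sub h3).mul h1).add ((contDiffAt_const.add h3).mul h2)).const_smul _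
    exact h4.congr_of_eventuallyEq
      (Filter.eventually_of_mem (hΩ.isOpen.mem_nhds hq) fun p hp => hφ.apply hp)

lemma IsSliceExt.isSliceHyperholomorphic (hΩ : IsAxSymSliceDomain Ω) (hI : I ∈ imagUnits)
    (hh : IsSliceHolo I (slicePt I ⁻¹' Ω) h) (hφ : IsSliceExt Ω I h φ) :
    IsSliceHyperholomorphic Ω φ := by
  refine ⟨(hφ.contDiffOn hΩ hI hh).of_le le_top, fun J hJ z hz => ?_⟩
  have hU := hΩ.isOpen_preimage J
  rw [hΩ.preimage_eq hI hJ] at hh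
  rw [← (hh.sliceFormula hI hJ hU fun z hz => hΩ.conj_mem hJ hz).2 z hz]
  exact dbar_eqOn hU (fun w hw => hφ J hJ w hw) hz

lemma IsSliceHyperholomorphic.contDiffOn (hΩ : IsAxSymSliceDomain Ω)
    (hφ : IsSliceHyperholomorphic Ω φ) : ContDiffOn ℝ ω φ Ω :=
  (hφ.isSliceExt hΩ e₁_mem).contDiffOn hΩ e₁_mem (hφ.isSliceHolo hΩ e₁_mem)

lemma IsSliceHyperholomorphic.isSliceFunction (hΩ : IsAxSymSliceDomain Ω)
    (hφ : IsSliceHyperholomorphic Ω φ) : IsSliceFunction Ω φ :=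
  (hφ.isSliceExt hΩ e₁_mem).isSliceFunction

/-! ### The poly-decomposition -/

theorem exists_isPolyDecomposition (hΩ : IsAxSymSliceDomain Ω) {n : ℕ} {f : ℍ → ℍ}
    (hf : IsSlicePolyanalytic n Ω f) : ∃ φ, IsPolyDecomposition n Ω f φ := by
  have hI := e₁_mem
  have hU := hΩ.isOpen_preimage e₁
  have hc : ContDiffOn ℝ n (f ∘ slicePt e₁) (slicePt e₁ ⁻¹' Ω) :=
    hf.2.1.comp (contDiff_slicePt e₁).contDiffOn fun _ hz => hz
  obtain ⟨h, hh, hsum⟩ := exists_sum_barPow hI hU n hc (hf.2.2 e₁ hI)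
  have hext := fun k => isSliceExt_sliceFormula Ω e₁ (h k)
  refine ⟨fun k q => sliceFormula e₁ (imDir q) (h k) (sliceCoord q),
    fun k hk => (hext k).isSliceHyperholomorphic hΩ hI (hh k hk), fun q hq => ?_⟩
  obtain ⟨J, hJ, hJq⟩ := exists_slicePt q
  generalize sliceCoord q = z at hJq
  subst hJq
  have hz := hΩ.axially_symmetric J hJ e₁ hI z hq
  rw [hf.1.isSliceExt hΩ hI J hJ z hq]
  have e : sliceFormula e₁ J (f ∘ slicePt e₁) z = sliceFormula e₁ J
      (fun w => ∑ k ∈ Finset.range n, slicePt e₁ (conj w) ^ k * h k w) z := by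
    rw [sliceFormula, sliceFormula, hsum z hz, hsum _ (hΩ.conj_mem hI hz)]
  rw [e, sliceFormula_sum]
  refine Finset.sum_congr rfl fun k _ => ?_
  rw [sliceFormula_barPow_mul hI hJ, star_slicePt hJ]
  exact congrArg _ (hext k J hJ z hq).symm

theorem IsPolyDecomposition.eqOn (hΩ : IsAxSymSliceDomain Ω) {n : ℕ} {f : ℍ → ℍ}
    {φ ψ : ℕ → ℍ → ℍ} (hφ : IsPolyDecomposition n Ω f φ) (hψ : IsPolyDecomposition n Ω f ψ) :
    ∀ k < n, Set.EqOn (φ k) (ψ k) Ω := by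
  intro k hk q hq
  obtain ⟨J, hJ, hJq⟩ := exists_slicePt q
  have hU := hΩ.isOpen_preimage J
  rw [← hJq] at hq ⊢
  have h1 := eq_zero_of_sum_barPow hJ hU (n := n)
    (h := fun k z => (φ k ∘ slicePt J) z - (ψ k ∘ slicePt J) z) (fun k hk => ?_) (fun z hz => ?_)
    k hk _ hq
  · exact sub_eq_zero.1 h1
  · have a1 := (hφ.1 k hk).isSliceHolo hΩ hJ
    have a2 := (hψ.1 k hk).isSliceHolo hΩ hJ
    refine ⟨a1.1.sub a2.1, fun z hz => ?_⟩
    rw [dbar_sub (a1.differentiableAt hU hz) (a2.differentiableAt hU hz), a1.2 z hz, a2.2 z hz,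
      sub_zero]
  · simp only [mul_sub, Finset.sum_sub_distrib, Function.comp_apply, ← star_slicePt hJ]
    rw [← hφ.2 _ hz, ← hψ.2 _ hz, sub_self]

end

/-! ### The global operator -/

section

variable {Ω : Set ℍ}

lemma im_eq_sum (q : ℍ) : q.im = q.imI • e₁ + q.imJ • e₂ + q.imK • e₃ := by
  ext <;> simp

lemma isClosed_realAxis : IsClosed realAxis :=
  isClosed_eq Quaternion.continuous_im continuous_const

lemma nhdsWithin_compl_realAxis_neBot (q : ℍ) : (𝓝[realAxisᶜ] q).NeBot := by
  rw [← mem_closure_iff_nhdsWithin_neBot, Metric.mem_closure_iff]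
  intro ε hε
  by_cases hq : q ∈ realAxis
  · have him : q.im = 0 := hq
    refine ⟨q + (ε / 2) • e₁, fun h => ?_, ?_⟩
    · have h' : (q + (ε / 2) • e₁).im = 0 := h
      have := congrArg (fun p : ℍ => p.imI) h'
      have h2 := congrArg (fun p : ℍ => p.imI) him
      simp only [Quaternion.imI_im, Quaternion.imI_add, Quaternion.imI_smul, imI_e₁,
        Quaternion.imI_zero, smul_eq_mul] at this h2
      linarith
    · rw [dist_self_add_right, norm_smul, norm_of_mem e₁_mem, mul_one, Real.norm_of_nonneg] <;>
        linarith
  · exact ⟨q, hq, by simpa using hε⟩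

/-- Off the real axis, `V` is twice the operator `∂̄_I` of the plane through the point. -/
lemma globalVOff_eq_dbar {f : ℍ → ℍ} {q : ℍ} (hf : DifferentiableAt ℝ f q) :
    globalVOff f q = (2 : ℝ) • dbar (imDir q) (f ∘ slicePt (imDir q)) (sliceCoord q) := by
  set J := imDir q with hJ
  have hq : slicePt J (sliceCoord q) = q := slicePt_imDir_sliceCoord q
  have h1 : HasFDerivAt (f ∘ slicePt J) ((fderiv ℝ f q).comp (slicePtL J)) (sliceCoord q) := by
    refine HasFDerivAt.comp (sliceCoord q) (by rw [hq]; exact hf.hasFDerivAt) ?_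
    rw [← coe_slicePtL]
    exact (slicePtL J).hasFDerivAt
  rw [dbar, h1.fderiv, smul_smul]
  simp only [ContinuousLinearMap.comp_apply, slicePtL_apply, slicePt_one, slicePt_I]
  have h2 : fderiv ℝ f q J = ‖q.im‖⁻¹ • (q.imI • fderiv ℝ f q e₁ + q.imJ • fderiv ℝ f q e₂ +
      q.imK • fderiv ℝ f q e₃) := by
    rw [hJ, imDir]
    rw [map_smul]
    congr 1
    conv_lhs => rw [im_eq_sum q]
    simp only [map_add, map_smul]
  rw [h2, globalVOff, hJ, imDir, smul_mul_smul_comm, ← sq, inv_pow]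
  norm_num

open Classical in
lemma globalV_eqOn {F G : ℍ → ℍ} (hΩ : IsOpen Ω) (h : Set.EqOn F G Ω) :
    Set.EqOn (globalV F) (globalV G) Ω := by
  have hoff : ∀ q ∈ Ω, globalVOff F q = globalVOff G q := fun q hq => by
    have : F =ᶠ[𝓝 q] G := h.eventuallyEq_of_mem (hΩ.mem_nhds hq)
    rw [globalVOff, globalVOff, this.fderiv_eq]
  intro q hq
  rw [globalV, globalV]
  split_ifs with hr
  · -- the limit only depends on the values near `q`
    have : globalVOff F =ᶠ[𝓝[realAxisᶜ] q] globalVOff G :=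
      Filter.Eventually.filter_mono nhdsWithin_le_nhds
        (Filter.eventually_of_mem (hΩ.mem_nhds hq) hoff)
    rw [Filter.limUnder, Filter.limUnder, Filter.map_congr this]
  · exact hoff q hq

lemma globalV_eqOn_of_continuousOn {F G : ℍ → ℍ} (hΩ : IsOpen Ω) (hG : ContinuousOn G Ω)
    (h : ∀ q ∈ Ω, q ∉ realAxis → globalVOff F q = G q) : Set.EqOn (globalV F) G Ω := by
  intro q hq
  rw [globalV]
  split_ifs with hr
  · have := nhdsWithin_compl_realAxis_neBot q
    refine Filter.Tendsto.limUnder_eq ?_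
    refine Filter.Tendsto.congr' (f₁ := G) ?_
      ((hG.continuousAt (hΩ.mem_nhds hq)).tendsto.mono_left nhdsWithin_le_nhds)
    filter_upwards [self_mem_nhdsWithin, nhdsWithin_le_nhds (hΩ.mem_nhds hq)] with p hp hpΩ
    exact (h p hpΩ hp).symm
  · exact h q hq hr

lemma contDiff_star_pow (j : ℕ) : ContDiff ℝ ω fun q : ℍ => star q ^ j := by
  have : (fun q : ℍ => star q ^ j) = fun q => (reL q • (1 : ℍ) - imL q) ^ j := by
    funext q
    congr 1
    ext <;> simp [reL_apply, imL_apply]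
  rw [this]
  fun_prop

lemma contDiffOn_sum_star_pow {n : ℕ} {φ : ℕ → ℍ → ℍ}
    (hφ : ∀ k < n, ContDiffOn ℝ ω (φ k) Ω) (r : ℕ → ℝ) (j : ℕ → ℕ) :
    ContDiffOn ℝ ω (fun q => ∑ k ∈ Finset.range n, r k • (star q ^ j k * φ k q)) Ω :=
  ContDiffOn.sum fun k hk => ContDiffOn.const_smul (r k)
    ((contDiff_star_pow (j k)).contDiffOn.mul (hφ k (Finset.mem_range.1 hk)))

lemma globalV_sum_star_pow (hΩ : IsAxSymSliceDomain Ω) {n : ℕ} {φ : ℕ → ℍ → ℍ}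
    (hφ : ∀ k < n, IsSliceHyperholomorphic Ω (φ k)) (r : ℕ → ℝ) (j : ℕ → ℕ) :
    Set.EqOn (globalV fun q => ∑ k ∈ Finset.range n, r k • (star q ^ j k * φ k q))
      (fun q => ∑ k ∈ Finset.range n, (r k * (2 * j k)) • (star q ^ (j k - 1) * φ k q)) Ω := by
  have hc := fun k hk => (hφ k hk).contDiffOn hΩ
  refine globalV_eqOn_of_continuousOn hΩ.isOpen (contDiffOn_sum_star_pow hc _ _).continuousOn
    fun q hq hr => ?_
  have hd : DifferentiableAt ℝ (fun q => ∑ k ∈ Finset.range n, r k • (star q ^ j k * φ k q)) q :=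
    ((contDiffOn_sum_star_pow hc r j).contDiffAt (hΩ.isOpen.mem_nhds hq)).differentiableAt (by simp)
  have hJ := imDir_mem hr
  have hz : sliceCoord q ∈ slicePt (imDir q) ⁻¹' Ω := hΩ.sliceCoord_mem hJ hq
  have h1 := dbar_sum_pow hJ (hΩ.isOpen_preimage (imDir q))
    (fun k hk => (hφ k hk).isSliceHolo hΩ hJ) r j hz
  have hfun : ((fun q => ∑ k ∈ Finset.range n, r k • (star q ^ j k * φ k q)) ∘ slicePt (imDir q)) =
      fun z => ∑ k ∈ Finset.range n,
        r k • (slicePt (imDir q) (conj z) ^ j k * (φ k ∘ slicePt (imDir q)) z) := by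
    funext z
    simp only [Function.comp_apply, star_slicePt hJ]
  rw [globalVOff_eq_dbar hd, hfun, h1]
  simp only [Function.comp_apply, ← star_slicePt hJ, slicePt_imDir_sliceCoord]
  rw [Finset.smul_sum]
  refine Finset.sum_congr rfl fun k _ => ?_
  rw [smul_smul]
  congr 1; ring

/-- `V^m f = ∑ 2^m k!/(k-m)! q̄^(k-m) f_k`. -/
lemma globalV_iterate (hΩ : IsAxSymSliceDomain Ω) {n : ℕ} {f : ℍ → ℍ} {φ : ℕ → ℍ → ℍ}
    (hφ : IsPolyDecomposition n Ω f φ) (m : ℕ) :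
    Set.EqOn (globalV^[m] f) (fun q => ∑ k ∈ Finset.range n,
      (2 ^ m * k.descFactorial m : ℝ) • (star q ^ (k - m) * φ k q)) Ω :=
  iterate_eqOn_sum (T := globalV) (b := fun j k q => star q ^ j * φ k q)
    (fun _ _ => globalV_eqOn hΩ.isOpen) (globalV_sum_star_pow hΩ hφ.1) (fun q hq => hφ.2 q hq) m

lemma contDiffOn_globalV_iterate (hΩ : IsAxSymSliceDomain Ω) {n : ℕ} {f : ℍ → ℍ}
    {φ : ℕ → ℍ → ℍ} (hφ : IsPolyDecomposition n Ω f φ) (m : ℕ) :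
    ContDiffOn ℝ ω (globalV^[m] f) Ω :=
  (contDiffOn_sum_star_pow (fun k hk => (hφ.1 k hk).contDiffOn hΩ) _ _).congr
    (globalV_iterate hΩ hφ m)

lemma globalV_iterate_pred (hΩ : IsAxSymSliceDomain Ω) {n : ℕ} (hn : 1 ≤ n) {f : ℍ → ℍ}
    {φ : ℕ → ℍ → ℍ} (hφ : IsPolyDecomposition n Ω f φ) :
    Set.EqOn (globalV^[n - 1] f)
      ((2 ^ (n - 1) * (n - 1).factorial : ℝ) • φ (n - 1)) Ω := by
  intro q hq
  rw [globalV_iterate hΩ hφ (n - 1) hq]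
  have := sum_descFactorial_pred hn (2 ^ (n - 1)) fun j k => star q ^ j * φ k q
  dsimp only
  rw [this, pow_zero, one_mul]
  rfl

end

/-! ### Partial derivatives, the Laplacian and the Cauchy-Fueter operator -/

section

variable {Ω : Set ℍ}

/-- The directional derivative in the constant direction `v`. -/
def dirDeriv {E : Type*} [NormedAddCommGroup E] [NormedSpace ℝ E] (v : E) (f : E → ℍ) (x : E) : ℍ :=
  fderiv ℝ f x v

section dirDeriv

variable {E : Type*} [NormedAddCommGroup E] [NormedSpace ℝ E] {U : Set E} {f g : E → ℍ}

lemma contDiffOn_dirDeriv (hU : IsOpen U) (hf : ContDiffOn ℝ ω f U) (v : E) :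
    ContDiffOn ℝ ω (dirDeriv v f) U :=
  (hf.fderiv_of_isOpen hU le_top).clm_apply contDiffOn_const

lemma dirDeriv_eqOn (hU : IsOpen U) (h : Set.EqOn f g U) (v : E) :
    Set.EqOn (dirDeriv v f) (dirDeriv v g) U := fun x hx => by
  have : f =ᶠ[𝓝 x] g := h.eventuallyEq_of_mem (hU.mem_nhds hx)
  rw [dirDeriv, dirDeriv, this.fderiv_eq]

lemma _root_.ContDiffOn.differentiableAt_of_omega (hU : IsOpen U) (hf : ContDiffOn ℝ ω f U) {x : E}
    (hx : x ∈ U) : DifferentiableAt ℝ f x :=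
  (hf.contDiffAt (hU.mem_nhds hx)).differentiableAt (by simp)

lemma dirDeriv_comm (hU : IsOpen U) (hf : ContDiffOn ℝ ω f U) (v w : E) {x : E} (hx : x ∈ U) :
    dirDeriv v (dirDeriv w f) x = dirDeriv w (dirDeriv v f) x := by
  have hd : DifferentiableAt ℝ (fderiv ℝ f) x :=
    ((hf.fderiv_of_isOpen hU (m := ω) le_top).contDiffAt (hU.mem_nhds hx)).differentiableAt
      (by simp)
  have key (v w : E) : dirDeriv v (dirDeriv w f) x = fderiv ℝ (fderiv ℝ f) x v w := by
    have : dirDeriv w f = fun y => fderiv ℝ f y w := rfl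
    rw [dirDeriv, this, fderiv_clm_apply hd (differentiableAt_const w)]
    simp
  rw [key, key]
  exact (hf.contDiffAt (hU.mem_nhds hx)).isSymmSndFDerivAt_of_omega v w

lemma dirDeriv_fun_sum {ι : Type*} {s : Finset ι} {F : ι → E → ℍ} {x : E}
    (hF : ∀ i ∈ s, DifferentiableAt ℝ (F i) x) (v : E) :
    dirDeriv v (fun y => ∑ i ∈ s, F i y) x = ∑ i ∈ s, dirDeriv v (F i) x := by
  rw [dirDeriv, fderiv_fun_sum hF, sum_apply]
  rfl

lemma dirDeriv_const_mul {x : E} (hf : DifferentiableAt ℝ f x) (a : ℍ) (v : E) :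
    dirDeriv v (fun y => a * f y) x = a * dirDeriv v f x := by
  rw [dirDeriv, fderiv_const_mul hf]
  rfl

end dirDeriv

/-- The standard basis `1, i, j, k` of the quaternions. -/
def stdBasis : Fin 4 → ℍ := ![1, e₁, e₂, e₃]

lemma cauchyFueter_eq_sum (f : ℍ → ℍ) (q : ℍ) :
    cauchyFueter f q = ∑ i, stdBasis i * dirDeriv (stdBasis i) f q := by
  simp [Fin.sum_univ_four, stdBasis, cauchyFueter, dirDeriv]

lemma laplacian_eq_sum (hΩ : IsOpen Ω) {f : ℍ → ℍ} (hf : ContDiffOn ℝ ω f Ω) {q : ℍ}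
    (hq : q ∈ Ω) :
    Laplacian.laplacian f q = ∑ i, dirDeriv (stdBasis i) (dirDeriv (stdBasis i) f) q := by
  have hd : DifferentiableAt ℝ (fderiv ℝ f) q :=
    ((hf.fderiv_of_isOpen hΩ (m := ω) le_top).contDiffAt (hΩ.mem_nhds hq)).differentiableAt
      (by simp)
  let b : OrthonormalBasis (Fin 4) ℝ ℍ :=
    OrthonormalBasis.ofRepr Quaternion.linearIsometryEquivTuple
  have hb (i : Fin 4) : b i = stdBasis i := by
    rw [← b.repr_symm_single]
    fin_cases i <;> ext <;>
      simp [b, stdBasis, Quaternion.linearIsometryEquivTuple_symm_apply]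
  rw [InnerProductSpace.laplacian_eq_iteratedFDeriv_orthonormalBasis f b]
  refine Finset.sum_congr rfl fun i _ => ?_
  have : dirDeriv (b i) f = fun y => fderiv ℝ f y (b i) := rfl
  rw [← hb, iteratedFDeriv_two_apply, dirDeriv, this,
    fderiv_clm_apply hd (differentiableAt_const _)]
  simp

lemma contDiffOn_laplacian (hΩ : IsOpen Ω) {f : ℍ → ℍ} (hf : ContDiffOn ℝ ω f Ω) :
    ContDiffOn ℝ ω (Laplacian.laplacian f) Ω :=
  (ContDiffOn.sum fun i _ => contDiffOn_dirDeriv hΩ (contDiffOn_dirDeriv hΩ hf (stdBasis i))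
    (stdBasis i)).congr fun _ hq => laplacian_eq_sum hΩ hf hq

lemma contDiffOn_cauchyFueter (hΩ : IsOpen Ω) {f : ℍ → ℍ} (hf : ContDiffOn ℝ ω f Ω) :
    ContDiffOn ℝ ω (cauchyFueter f) Ω :=
  (ContDiffOn.sum fun i _ => contDiffOn_const.mul (contDiffOn_dirDeriv hΩ hf (stdBasis i))).congr
    fun q _ => cauchyFueter_eq_sum f q

lemma laplacian_eqOn (hΩ : IsOpen Ω) {f g : ℍ → ℍ} (h : Set.EqOn f g Ω) :
    Set.EqOn (Laplacian.laplacian f) (Laplacian.laplacian g) Ω := fun _ hq =>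
  (InnerProductSpace.laplacian_congr_nhds (h.eventuallyEq_of_mem (hΩ.mem_nhds hq))).eq_of_nhds

lemma cauchyFueter_eqOn (hΩ : IsOpen Ω) {f g : ℍ → ℍ} (h : Set.EqOn f g Ω) :
    Set.EqOn (cauchyFueter f) (cauchyFueter g) Ω := fun q hq => by
  simp only [cauchyFueter_eq_sum, dirDeriv_eqOn hΩ h _ hq]

lemma cauchyFueter_laplacian (hΩ : IsOpen Ω) {f : ℍ → ℍ} (hf : ContDiffOn ℝ ω f Ω) {q : ℍ}
    (hq : q ∈ Ω) :
    cauchyFueter (Laplacian.laplacian f) q = Laplacian.laplacian (cauchyFueter f) q := by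
  have hd (v : ℍ) {g : ℍ → ℍ} (hg : ContDiffOn ℝ ω g Ω) : ContDiffOn ℝ ω (dirDeriv v g) Ω :=
    contDiffOn_dirDeriv hΩ hg v
  rw [cauchyFueter_eq_sum, laplacian_eq_sum hΩ (contDiffOn_cauchyFueter hΩ hf) hq]
  have h1 (v : ℍ) : dirDeriv v (Laplacian.laplacian f) q =
      ∑ j, dirDeriv (stdBasis j) (dirDeriv (stdBasis j) (dirDeriv v f)) q := by
    rw [dirDeriv_eqOn hΩ (fun p hp => laplacian_eq_sum hΩ hf hp) v hq,
      dirDeriv_fun_sum fun j _ => (hd _ (hd _ hf)).differentiableAt_of_omega hΩ hq]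
    refine Finset.sum_congr rfl fun j _ => ?_
    rw [dirDeriv_comm hΩ (hd _ hf) _ _ hq]
    exact dirDeriv_eqOn hΩ (fun p hp => dirDeriv_comm hΩ hf _ _ hp) _ hq
  have h2 (v : ℍ) : dirDeriv v (dirDeriv v (cauchyFueter f)) q =
      ∑ i, stdBasis i * dirDeriv v (dirDeriv v (dirDeriv (stdBasis i) f)) q := by
    have h3 : Set.EqOn (dirDeriv v (cauchyFueter f))
        (fun p => ∑ i, stdBasis i * dirDeriv v (dirDeriv (stdBasis i) f) p) Ω := by
      intro p hp
      have : cauchyFueter f = fun p => ∑ i, stdBasis i * dirDeriv (stdBasis i) f p :=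
        funext (cauchyFueter_eq_sum f)
      rw [this, dirDeriv_fun_sum fun j _ =>
        ((hd _ hf).differentiableAt_of_omega hΩ hp).const_mul _]
      exact Finset.sum_congr rfl fun j _ =>
        dirDeriv_const_mul ((hd _ hf).differentiableAt_of_omega hΩ hp) _ _
    rw [dirDeriv_eqOn hΩ h3 v hq, dirDeriv_fun_sum fun j _ =>
      ((hd _ (hd _ hf)).differentiableAt_of_omega hΩ hq).const_mul _]
    exact Finset.sum_congr rfl fun j _ =>
      dirDeriv_const_mul ((hd _ (hd _ hf)).differentiableAt_of_omega hΩ hq) _ _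
  simp only [h1, h2, Finset.mul_sum]
  exact Finset.sum_comm

/-! ### Functions of `x₀` and `|q⃗|` -/

lemma hasFDerivAt_norm_im {q : ℍ} (hq : q ∉ realAxis) :
    HasFDerivAt (fun p : ℍ => ‖p.im‖) ((‖q.im‖⁻¹ : ℝ) • (innerSL ℝ q.im)) q := by
  have hne : ‖q.im‖ ≠ 0 := by simpa [realAxis] using hq
  have h1 : HasFDerivAt (fun p : ℍ => ‖p.im‖ ^ 2) ((2 : ℝ) • (innerSL ℝ q.im).comp imL) q := by
    have := (imL.hasFDerivAt (x := q)).norm_sq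
    simp only [imL_apply] at this
    exact_mod_cast this
  have h2 := h1.sqrt (pow_ne_zero 2 hne)
  simp only [Real.sqrt_sq (norm_nonneg _)] at h2
  refine h2.congr_fderiv (ContinuousLinearMap.ext fun v => ?_)
  have : inner ℝ q.im v = inner ℝ q.im (imL v) := by
    simp only [Quaternion.inner_def, imL_apply]
    simp
    ring
  simp only [smul_apply, innerSL_apply_apply, ContinuousLinearMap.comp_apply, smul_eq_mul, this]
  field_simp

lemma hasFDerivAt_sliceCoord {q : ℍ} (hq : q ∉ realAxis) :
    HasFDerivAt sliceCoord (reL.smulRight (1 : ℂ) +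
      ((‖q.im‖⁻¹ : ℝ) • (innerSL ℝ q.im)).smulRight Complex.I) q := by
  have : sliceCoord = fun q : ℍ => reL q • (1 : ℂ) + ‖q.im‖ • Complex.I := by
    funext q; apply Complex.ext <;> simp [sliceCoord, reL_apply]
  rw [this]
  exact (reL.hasFDerivAt.smul_const _).add ((hasFDerivAt_norm_im hq).smul_const _)

lemma dirDeriv_comp_sliceCoord {q : ℍ} (hq : q ∉ realAxis) {u : ℂ → ℍ}
    (hu : DifferentiableAt ℝ u (sliceCoord q)) (v : ℍ) :
    dirDeriv v (u ∘ sliceCoord) q = v.re • dirDeriv 1 u (sliceCoord q) +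
      (‖q.im‖⁻¹ * inner ℝ q.im v) • dirDeriv Complex.I u (sliceCoord q) := by
  rw [dirDeriv, (hu.hasFDerivAt.comp q (hasFDerivAt_sliceCoord hq)).fderiv]
  simp only [ContinuousLinearMap.comp_apply, add_apply, ContinuousLinearMap.smulRight_apply,
    reL_apply, smul_apply, innerSL_apply_apply, map_add, map_smul, smul_eq_mul, dirDeriv]

lemma dirDeriv_smul {E : Type*} [NormedAddCommGroup E] [NormedSpace ℝ E]
    {c : E → ℝ} {c' : E →L[ℝ] ℝ}
    {g : E → ℍ} {x : E} (hc : HasFDerivAt c c' x) (hg : DifferentiableAt ℝ g x) (v : E) :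
    dirDeriv v (fun y => c y • g y) x = c x • dirDeriv v g x + c' v • g x := by
  rw [dirDeriv, (hc.fun_smul hg.hasFDerivAt).fderiv]
  simp [dirDeriv]

lemma inner_im_stdBasis (q : ℍ) (i : Fin 4) :
    inner ℝ q.im (stdBasis i) = (![0, q.imI, q.imJ, q.imK] : Fin 4 → ℝ) i := by
  fin_cases i <;> simp [stdBasis, Quaternion.inner_def]

lemma norm_im_sq (q : ℍ) : ‖q.im‖ ^ 2 = q.imI ^ 2 + q.imJ ^ 2 + q.imK ^ 2 := by
  rw [sq, ← Quaternion.normSq_eq_norm_mul_self, Quaternion.normSq_def']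
  simp

lemma hasFDerivAt_inner_im (v q : ℍ) :
    HasFDerivAt (fun p : ℍ => inner ℝ p.im v) ((innerSL ℝ v).comp imL) q := by
  have : (fun p : ℍ => (inner ℝ p.im v : ℝ)) = (innerSL ℝ v).comp imL := by
    funext p; simp [imL_apply, real_inner_comm]
  rw [this]
  exact ContinuousLinearMap.hasFDerivAt _

variable {W : Set ℂ} {O : Set ℍ}

/-- The second derivative of a function of `x₀` and `|q⃗|` in the direction of an imaginary
unit. -/
lemma dirDeriv_dirDeriv_comp_sliceCoord (hW : IsOpen W) (hO : IsOpen O)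
    (hOr : ∀ q ∈ O, q ∉ realAxis) (hOW : ∀ q ∈ O, sliceCoord q ∈ W) {u : ℂ → ℍ}
    (hu : ContDiffOn ℝ ω u W) {v : ℍ} (hv : v ∈ imagUnits) {q : ℍ} (hq : q ∈ O) :
    dirDeriv v (dirDeriv v (u ∘ sliceCoord)) q =
      (‖q.im‖⁻¹ - ‖q.im‖⁻¹ ^ 3 * inner ℝ q.im v ^ 2) • dirDeriv Complex.I u (sliceCoord q) +
      (‖q.im‖⁻¹ * inner ℝ q.im v) ^ 2 •
        dirDeriv Complex.I (dirDeriv Complex.I u) (sliceCoord q) := by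
  have hr : ‖q.im‖ ≠ 0 := by simpa [realAxis] using hOr q hq
  have h1 : Set.EqOn (dirDeriv v (u ∘ sliceCoord)) (fun p => (‖p.im‖⁻¹ * inner ℝ p.im v) •
      (dirDeriv Complex.I u ∘ sliceCoord) p) O := by
    intro p hp
    rw [dirDeriv_comp_sliceCoord (hOr p hp) (hu.differentiableAt_of_omega hW (hOW p hp)),
      re_eq_zero_of_mem hv, zero_smul, zero_add]
    rfl
  have hd : DifferentiableAt ℝ (dirDeriv Complex.I u) (sliceCoord q) :=
    (contDiffOn_dirDeriv hW hu _).differentiableAt_of_omega hW (hOW q hq)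
  have hn := hasFDerivAt_norm_im (hOr q hq)
  have hg : HasFDerivAt (fun p : ℍ => ‖p.im‖⁻¹ * inner ℝ p.im v) _ q :=
    ((hasDerivAt_inv hr).comp_hasFDerivAt q hn).mul (hasFDerivAt_inner_im v q)
  rw [dirDeriv_eqOn hO h1 v hq, dirDeriv_smul hg
      (hd.comp q (hasFDerivAt_sliceCoord (hOr q hq)).differentiableAt),
    dirDeriv_comp_sliceCoord (hOr q hq) hd, re_eq_zero_of_mem hv, zero_smul, zero_add, smul_smul,
    ← sq, add_comm]
  congr 2
  have hvv : inner ℝ v v = (1 : ℝ) := by rw [real_inner_self_eq_norm_sq, norm_of_mem hv, one_pow]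
  simp only [add_apply, smul_apply, ContinuousLinearMap.comp_apply, Function.comp_apply,
    innerSL_apply_apply, imL_apply,
    im_of_mem hv, hvv, smul_eq_mul, mul_one]
  field_simp
  ring

/-- The Laplacian of a function of `x₀` and `y = |q⃗|` is `∂_x² + ∂_y² + (2 / y) ∂_y`. -/
lemma laplacian_comp_sliceCoord (hW : IsOpen W) (hO : IsOpen O)
    (hOr : ∀ q ∈ O, q ∉ realAxis) (hOW : ∀ q ∈ O, sliceCoord q ∈ W) {u : ℂ → ℍ}
    (hu : ContDiffOn ℝ ω u W) {q : ℍ} (hq : q ∈ O) :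
    Laplacian.laplacian (u ∘ sliceCoord) q =
      dirDeriv 1 (dirDeriv 1 u) (sliceCoord q) +
      dirDeriv Complex.I (dirDeriv Complex.I u) (sliceCoord q) +
      (2 * ‖q.im‖⁻¹) • dirDeriv Complex.I u (sliceCoord q) := by
  have hr : ‖q.im‖ ≠ 0 := by simpa [realAxis] using hOr q hq
  have hc : ContDiffOn ℝ ω (u ∘ sliceCoord) O := fun p hp =>
    ((hu.contDiffAt (hW.mem_nhds (hOW p hp))).comp p
      (contDiffAt_sliceCoord (hOr p hp))).contDiffWithinAt
  have h1 {w : ℂ → ℍ} (hw : ContDiffOn ℝ ω w W) : Set.EqOn (dirDeriv 1 (w ∘ sliceCoord))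
      (dirDeriv 1 w ∘ sliceCoord) O := by
    intro p hp
    rw [dirDeriv_comp_sliceCoord (hOr p hp) (hw.differentiableAt_of_omega hW (hOW p hp))]
    have := inner_im_stdBasis p 0
    simp only [stdBasis, Matrix.cons_val_zero] at this
    rw [this]
    simp
  have h11 : dirDeriv 1 (dirDeriv 1 (u ∘ sliceCoord)) q =
      dirDeriv 1 (dirDeriv 1 u) (sliceCoord q) := by
    rw [dirDeriv_eqOn hO (h1 hu) 1 hq, h1 (contDiffOn_dirDeriv hW hu 1) hq]
    rfl
  have k1 := inner_im_stdBasis q 1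
  have k2 := inner_im_stdBasis q 2
  have k3 := inner_im_stdBasis q 3
  simp only [stdBasis, Matrix.cons_val] at k1 k2 k3
  rw [laplacian_eq_sum hO hc hq, Fin.sum_univ_four]
  simp only [stdBasis, Matrix.cons_val]
  rw [h11, dirDeriv_dirDeriv_comp_sliceCoord hW hO hOr hOW hu e₁_mem hq,
    dirDeriv_dirDeriv_comp_sliceCoord hW hO hOr hOW hu e₂_mem hq,
    dirDeriv_dirDeriv_comp_sliceCoord hW hO hOr hOW hu e₃_mem hq, k1, k2, k3]
  have hsum := norm_im_sq q
  set r := ‖q.im‖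
  have e1 : (r⁻¹ - r⁻¹ ^ 3 * q.imI ^ 2) + (r⁻¹ - r⁻¹ ^ 3 * q.imJ ^ 2) +
      (r⁻¹ - r⁻¹ ^ 3 * q.imK ^ 2) = 2 * r⁻¹ := by
    have : q.imK ^ 2 = r ^ 2 - q.imI ^ 2 - q.imJ ^ 2 := by linarith
    rw [this]; field_simp; ring
  have e2 : (r⁻¹ * q.imI) ^ 2 + (r⁻¹ * q.imJ) ^ 2 + (r⁻¹ * q.imK) ^ 2 = 1 := by
    have : q.imK ^ 2 = r ^ 2 - q.imI ^ 2 - q.imJ ^ 2 := by linarith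
    rw [mul_pow, mul_pow, mul_pow, this]; field_simp; ring
  rw [← e1]
  linear_combination (norm := module) e2 • dirDeriv Complex.I (dirDeriv Complex.I u) (sliceCoord q)

end

/-! ### Fueter's theorem -/

section

variable {Ω : Set ℍ}

section CauchyRiemann

variable {I : ℍ} {U : Set ℂ} {h : ℂ → ℍ}

lemma contDiffOn_comp_conj (hconj : ∀ z ∈ U, conj z ∈ U) (hh : ContDiffOn ℝ ω h U) :
    ContDiffOn ℝ ω (fun z => h (conj z)) U :=
  hh.comp Complex.conjCLE.contDiff.contDiffOn hconj

lemma contDiffOn_evenPart (hconj : ∀ z ∈ U, conj z ∈ U) (hh : ContDiffOn ℝ ω h U) :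
    ContDiffOn ℝ ω (evenPart h) U :=
  (hh.add (contDiffOn_comp_conj hconj hh)).const_smul (1 / 2 : ℝ)

lemma contDiffOn_oddPart (hconj : ∀ z ∈ U, conj z ∈ U) (hh : ContDiffOn ℝ ω h U) :
    ContDiffOn ℝ ω (oddPart I h) U :=
  (contDiffOn_const.mul ((contDiffOn_comp_conj hconj hh).sub hh)).const_smul (1 / 2 : ℝ)

lemma dirDeriv_evenPart {z : ℂ} (hz : DifferentiableAt ℝ h z)
    (hz' : DifferentiableAt ℝ h (conj z)) (w : ℂ) :
    dirDeriv w (evenPart h) z = (1 / 2 : ℝ) • (dirDeriv w h z + dirDeriv (conj w) h (conj z)) := by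
  have h2 : HasFDerivAt (fun w => h (conj w))
      ((fderiv ℝ h (conj z)).comp (Complex.conjCLE : ℂ →L[ℝ] ℂ)) z :=
    hz'.hasFDerivAt.comp z Complex.conjCLE.hasFDerivAt
  have h3 : HasFDerivAt (evenPart h) _ z := (hz.hasFDerivAt.add h2).const_smul (1 / 2 : ℝ)
  rw [dirDeriv, h3.fderiv]
  rfl

lemma dirDeriv_oddPart {z : ℂ} (hz : DifferentiableAt ℝ h z)
    (hz' : DifferentiableAt ℝ h (conj z)) (w : ℂ) :
    dirDeriv w (oddPart I h) z =
      (1 / 2 : ℝ) • (I * (dirDeriv (conj w) h (conj z) - dirDeriv w h z)) := by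
  have h2 : HasFDerivAt (fun w => h (conj w))
      ((fderiv ℝ h (conj z)).comp (Complex.conjCLE : ℂ →L[ℝ] ℂ)) z :=
    hz'.hasFDerivAt.comp z Complex.conjCLE.hasFDerivAt
  have h3 : HasFDerivAt (oddPart I h) _ z :=
    ((h2.sub hz.hasFDerivAt).const_mul I).const_smul (1 / 2 : ℝ)
  rw [dirDeriv, h3.fderiv]
  rfl

lemma cauchyRiemann_one (hI : I ∈ imagUnits) (hU : IsOpen U) (hconj : ∀ z ∈ U, conj z ∈ U)
    (hh : IsSliceHolo I U h) {z : ℂ} (hz : z ∈ U) :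
    dirDeriv Complex.I (oddPart I h) z = dirDeriv 1 (evenPart h) z := by
  have d1 := hh.differentiableAt hU hz
  have d2 := hh.differentiableAt hU (hconj z hz)
  have h1 : dirDeriv Complex.I h z = I * dirDeriv 1 h z := (dbar_eq_zero_iff hI).1 (hh.2 z hz)
  have h2 : dirDeriv Complex.I h (conj z) = I * dirDeriv 1 h (conj z) :=
    (dbar_eq_zero_iff hI).1 (hh.2 _ (hconj z hz))
  have h3 : dirDeriv (-Complex.I) h (conj z) = -dirDeriv Complex.I h (conj z) := map_neg _ _
  rw [dirDeriv_evenPart d1 d2, dirDeriv_oddPart d1 d2, Complex.conj_I, map_one, h3, h1, h2,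
    mul_sub, mul_neg, ← mul_assoc, ← mul_assoc, mul_self_of_mem hI]
  congr 1
  noncomm_ring

lemma cauchyRiemann_I (hI : I ∈ imagUnits) (hU : IsOpen U) (hconj : ∀ z ∈ U, conj z ∈ U)
    (hh : IsSliceHolo I U h) {z : ℂ} (hz : z ∈ U) :
    dirDeriv Complex.I (evenPart h) z = -dirDeriv 1 (oddPart I h) z := by
  have d1 := hh.differentiableAt hU hz
  have d2 := hh.differentiableAt hU (hconj z hz)
  have h1 : dirDeriv Complex.I h z = I * dirDeriv 1 h z := (dbar_eq_zero_iff hI).1 (hh.2 z hz)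
  have h2 : dirDeriv Complex.I h (conj z) = I * dirDeriv 1 h (conj z) :=
    (dbar_eq_zero_iff hI).1 (hh.2 _ (hconj z hz))
  have h3 : dirDeriv (-Complex.I) h (conj z) = -dirDeriv Complex.I h (conj z) := map_neg _ _
  rw [dirDeriv_evenPart d1 d2, dirDeriv_oddPart d1 d2, Complex.conj_I, map_one, h3, h1, h2,
    ← smul_neg]
  congr 1
  noncomm_ring

lemma oddPart_harmonic (hI : I ∈ imagUnits) (hU : IsOpen U) (hconj : ∀ z ∈ U, conj z ∈ U)
    (hh : IsSliceHolo I U h) {z : ℂ} (hz : z ∈ U) :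
    dirDeriv 1 (dirDeriv 1 (oddPart I h)) z +
      dirDeriv Complex.I (dirDeriv Complex.I (oddPart I h)) z = 0 := by
  have hc := contDiffOn_evenPart hconj (hh.contDiffOn hI hU)
  have h1 : dirDeriv 1 (dirDeriv Complex.I (evenPart h)) z =
      -dirDeriv 1 (dirDeriv 1 (oddPart I h)) z := by
    rw [dirDeriv_eqOn hU (fun w hw => cauchyRiemann_I hI hU hconj hh hw) 1 hz, dirDeriv,
      fderiv_fun_neg]
    rfl
  rw [dirDeriv_eqOn hU (fun w hw => cauchyRiemann_one hI hU hconj hh hw) Complex.I hz,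
    dirDeriv_comm hU hc _ _ hz, h1, add_neg_cancel]

end CauchyRiemann

lemma dirDeriv_inv_im_smul {g : ℂ → ℍ} {z : ℂ} (hz : z.im ≠ 0) (hg : DifferentiableAt ℝ g z)
    (w : ℂ) : dirDeriv w (fun y => y.im⁻¹ • g y) z =
      z.im⁻¹ • dirDeriv w g z - (w.im * z.im⁻¹ ^ 2) • g z := by
  have h1 : HasFDerivAt (fun y : ℂ => y.im⁻¹) _ z :=
    (hasDerivAt_inv hz).comp_hasFDerivAt z Complex.imCLM.hasFDerivAt
  rw [dirDeriv_smul h1 hg, sub_eq_add_neg, ← neg_smul]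
  congr 2
  simp only [smul_apply, Complex.imCLM_apply, smul_eq_mul]
  ring

lemma contDiffOn_inv_im_smul {g : ℂ → ℍ} {W : Set ℂ} (hW : ∀ z ∈ W, z.im ≠ 0)
    (hg : ContDiffOn ℝ ω g W) : ContDiffOn ℝ ω (fun z : ℂ => z.im⁻¹ • g z) W :=
  (ContDiffOn.inv Complex.imCLM.contDiff.contDiffOn hW).smul hg

/-- If `β` is harmonic, then `β / y` is annihilated by `∂_x² + ∂_y² + (2 / y) ∂_y`. -/
lemma laplacian_inv_im_smul {g : ℂ → ℍ} {W : Set ℂ} (hWo : IsOpen W) (hW : ∀ z ∈ W, z.im ≠ 0)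
    (hg : ContDiffOn ℝ ω g W) {z : ℂ} (hz : z ∈ W)
    (hharm : dirDeriv 1 (dirDeriv 1 g) z + dirDeriv Complex.I (dirDeriv Complex.I g) z = 0) :
    dirDeriv 1 (dirDeriv 1 fun y => y.im⁻¹ • g y) z +
      dirDeriv Complex.I (dirDeriv Complex.I fun y => y.im⁻¹ • g y) z +
      (2 * z.im⁻¹) • dirDeriv Complex.I (fun y => y.im⁻¹ • g y) z = 0 := by
  set b : ℂ → ℍ := fun y => y.im⁻¹ • g y with hb
  have hbc : ContDiffOn ℝ ω b W := contDiffOn_inv_im_smul hW hg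
  have hd (w : ℂ) : ContDiffOn ℝ ω (dirDeriv w g) W := contDiffOn_dirDeriv hWo hg w
  have h1 : Set.EqOn (dirDeriv 1 b) (fun y => y.im⁻¹ • dirDeriv 1 g y) W := fun y hy => by
    rw [hb, dirDeriv_inv_im_smul (hW y hy) (hg.differentiableAt_of_omega hWo hy)]
    simp
  have h2 : Set.EqOn (dirDeriv Complex.I b)
      (fun y => y.im⁻¹ • dirDeriv Complex.I g y - y.im⁻¹ • b y) W := fun y hy => by
    rw [hb, dirDeriv_inv_im_smul (hW y hy) (hg.differentiableAt_of_omega hWo hy)]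
    simp [smul_smul, sq]
  have h11 : dirDeriv 1 (dirDeriv 1 b) z = z.im⁻¹ • dirDeriv 1 (dirDeriv 1 g) z := by
    rw [dirDeriv_eqOn hWo h1 1 hz,
      dirDeriv_inv_im_smul (hW z hz) ((hd 1).differentiableAt_of_omega hWo hz)]
    simp
  have h22 : dirDeriv Complex.I (dirDeriv Complex.I b) z =
      (z.im⁻¹ • dirDeriv Complex.I (dirDeriv Complex.I g) z -
        z.im⁻¹ ^ 2 • dirDeriv Complex.I g z) -
      (z.im⁻¹ • dirDeriv Complex.I b z - z.im⁻¹ ^ 2 • b z) := by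
    have d1 := (contDiffOn_inv_im_smul hW (hd Complex.I)).differentiableAt_of_omega hWo hz
    have d2 := (contDiffOn_inv_im_smul hW hbc).differentiableAt_of_omega hWo hz
    have e1 := dirDeriv_inv_im_smul (hW z hz)
      ((hd Complex.I).differentiableAt_of_omega hWo hz) Complex.I
    have e2 := dirDeriv_inv_im_smul (hW z hz) (hbc.differentiableAt_of_omega hWo hz) Complex.I
    simp only [Complex.I_im, one_mul] at e1 e2
    rw [dirDeriv_eqOn hWo h2 Complex.I hz, dirDeriv, fderiv_fun_sub d1 d2, sub_apply, ← e1, ← e2]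
    rfl
  rw [h11, h22, h2 hz]
  linear_combination (norm := module) z.im⁻¹ • hharm

variable {I : ℍ} {h : ℂ → ℍ} {φ : ℍ → ℍ}

/-- For slice hyperholomorphic `φ = α + I β`, one has `𝒟 φ = -2 β / y` off the real axis. -/
lemma cauchyFueter_eq_neg_two_smul (hΩ : IsAxSymSliceDomain Ω) (hI : I ∈ imagUnits)
    (hh : IsSliceHolo I (slicePt I ⁻¹' Ω) h) (hφ : IsSliceExt Ω I h φ) {q : ℍ} (hq : q ∈ Ω)
    (hr : q ∉ realAxis) :
    cauchyFueter φ q =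
      (-2 : ℝ) • ((fun z : ℂ => z.im⁻¹ • oddPart I h z) ∘ sliceCoord) q := by
  set U := slicePt I ⁻¹' Ω
  have hU : IsOpen U := hΩ.isOpen_preimage I
  have hconj : ∀ z ∈ U, conj z ∈ U := fun z hz => hΩ.conj_mem hI hz
  have hc := hh.contDiffOn hI hU
  have hz : sliceCoord q ∈ U := hΩ.sliceCoord_mem hI hq
  have hr0 : ‖q.im‖ ≠ 0 := by simpa [realAxis] using hr
  have him : (sliceCoord q).im = ‖q.im‖ := rfl
  set b : ℂ → ℍ := fun z => z.im⁻¹ • oddPart I h z with hb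
  have dα := (contDiffOn_evenPart hconj hc).differentiableAt_of_omega hU hz
  have dβ := (contDiffOn_oddPart (I := I) hconj hc).differentiableAt_of_omega hU hz
  have db : DifferentiableAt ℝ b (sliceCoord q) :=
    DifferentiableAt.smul
      (Complex.imCLM.differentiableAt.inv (by rw [Complex.imCLM_apply, him]; exact hr0)) dβ
  -- `φ = α + q⃗ (β / y)` near `q`
  have hloc : φ =ᶠ[𝓝 q] fun p => (evenPart h ∘ sliceCoord) p + imL p * (b ∘ sliceCoord) p := by
    filter_upwards [hΩ.isOpen.mem_nhds hq] with p hp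
    rw [hφ.apply hp, sliceFormula_eq_evenPart_add, imDir, imL_apply, smul_mul_assoc,
      ← mul_smul_comm]
    rfl
  have dsc := (hasFDerivAt_sliceCoord hr).differentiableAt
  have hdir (v : ℍ) : dirDeriv v φ q = dirDeriv v (evenPart h ∘ sliceCoord) q +
      (v.im * b (sliceCoord q) + q.im * dirDeriv v (b ∘ sliceCoord) q) := by
    have a1 := (dα.comp q dsc).hasFDerivAt.add
      ((imL.hasFDerivAt (x := q)).mul' (db.comp q dsc).hasFDerivAt)
    rw [dirDeriv, hloc.fderiv_eq]
    erw [a1.fderiv]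
    simp [imL_apply, dirDeriv, add_comm]
  -- Cauchy-Riemann expresses the derivatives of `β / y` by those of `α` and by `β / y` itself
  have cr1 := cauchyRiemann_one hI hU hconj hh hz
  have cr2 := cauchyRiemann_I hI hU hconj hh hz
  have bx := dirDeriv_inv_im_smul (z := sliceCoord q) hr0 dβ 1
  have hby0 := dirDeriv_inv_im_smul (z := sliceCoord q) hr0 dβ Complex.I
  simp only [dirDeriv_comp_sliceCoord hr dα, dirDeriv_comp_sliceCoord hr db] at hdir
  rw [cr1, Complex.I_im, one_mul, him] at hby0
  rw [← neg_eq_iff_eq_neg.2 cr2, Complex.one_im, zero_mul, zero_smul, sub_zero, him] at bx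
  have hb0 : b (sliceCoord q) = ‖q.im‖⁻¹ • oddPart I h (sliceCoord q) := rfl
  have hby : dirDeriv Complex.I b (sliceCoord q) =
      ‖q.im‖⁻¹ • dirDeriv 1 (evenPart h) (sliceCoord q) - ‖q.im‖⁻¹ • b (sliceCoord q) := by
    rw [hb0, smul_smul, ← sq]; exact hby0
  have hbx : dirDeriv 1 b (sliceCoord q) =
      ‖q.im‖⁻¹ • -dirDeriv Complex.I (evenPart h) (sliceCoord q) := bx
  have k (i : Fin 4) := inner_im_stdBasis q i
  have k0 := k 0
  have k1 := k 1
  have k2 := k 2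
  have k3 := k 3
  simp only [stdBasis, Matrix.cons_val] at k0 k1 k2 k3
  rw [cauchyFueter_eq_sum, Fin.sum_univ_four]
  simp only [stdBasis, Matrix.cons_val]
  rw [hdir, hdir, hdir, hdir, k0, k1, k2, k3, im_of_mem e₁_mem, im_of_mem e₂_mem, im_of_mem e₃_mem,
    re_eq_zero_of_mem e₁_mem, re_eq_zero_of_mem e₂_mem, re_eq_zero_of_mem e₃_mem,
    Function.comp_apply,
    Quaternion.re_one, show (1 : ℍ).im = 0 by ext <;> simp]
  change _ = (-2 : ℝ) • b (sliceCoord q)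
  simp only [zero_smul, zero_add, zero_mul, mul_zero, add_zero, one_smul, one_mul]
  have hm := im_mul_im q
  have hs := im_eq_sum q
  generalize dirDeriv 1 (evenPart h) (sliceCoord q) = αx at *
  generalize dirDeriv Complex.I (evenPart h) (sliceCoord q) = αy at *
  generalize dirDeriv 1 b (sliceCoord q) = bX at *
  generalize dirDeriv Complex.I b (sliceCoord q) = bY at *
  generalize b (sliceCoord q) = b0 at *
  -- the sums over the three imaginary directions, for the three terms of `hdir`
  have hA : ∀ x : ℍ, e₁ * ((‖q.im‖⁻¹ * q.imI) • x) + e₂ * ((‖q.im‖⁻¹ * q.imJ) • x) +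
      e₃ * ((‖q.im‖⁻¹ * q.imK) • x) = ‖q.im‖⁻¹ • (q.im * x) := by
    intro x
    simp only [mul_smul_comm, mul_smul, ← smul_add]
    congr 1
    conv_rhs => rw [hs]
    simp only [add_mul, smul_mul_assoc]
  have hB : e₁ * (e₁ * b0) + e₂ * (e₂ * b0) + e₃ * (e₃ * b0) = (-3 : ℝ) • b0 := by
    simp only [← mul_assoc, mul_self_of_mem e₁_mem, mul_self_of_mem e₂_mem, mul_self_of_mem e₃_mem]
    simp only [neg_one_mul]
    module
  have hC : e₁ * (q.im * ((‖q.im‖⁻¹ * q.imI) • bY)) + e₂ * (q.im * ((‖q.im‖⁻¹ * q.imJ) • bY)) +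
      e₃ * (q.im * ((‖q.im‖⁻¹ * q.imK) • bY)) = (-‖q.im‖) • bY := by
    simp only [mul_smul_comm _ q.im]
    rw [hA, ← mul_assoc, hm, ← Quaternion.coe_neg, Quaternion.coe_mul_eq_smul, smul_smul]
    congr 1
    field_simp
  have hD : q.im * bX = -(‖q.im‖⁻¹ • (q.im * αy)) := by
    rw [hbx, mul_smul_comm, mul_neg, smul_neg]
  have hE : (-‖q.im‖) • bY = b0 - αx := by
    rw [hby, ← smul_sub, smul_smul, neg_mul, mul_inv_cancel₀ hr0, neg_one_smul, neg_sub]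
  rw [hD]
  simp only [mul_add]
  linear_combination (norm := module) hA αy + hB + hC + hE

/-- **Fueter's theorem**: `𝒟 Δ φ = 0`. Off the real axis, `𝒟 Δ φ = Δ 𝒟 φ = -2 Δ (β / y) = 0`
because `β` is harmonic; the real points follow by continuity. -/
theorem cauchyFueter_laplacian_eq_zero (hΩ : IsAxSymSliceDomain Ω)
    (hφ : IsSliceHyperholomorphic Ω φ) : ∀ q ∈ Ω, cauchyFueter (Laplacian.laplacian φ) q = 0 := by
  have hI := e₁_mem
  have hext := hφ.isSliceExt hΩ hI
  have hh := hφ.isSliceHolo hΩ hI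
  have hc := hφ.contDiffOn hΩ
  set h := φ ∘ slicePt e₁
  set U := slicePt e₁ ⁻¹' Ω
  have hU : IsOpen U := hΩ.isOpen_preimage e₁
  have hconj : ∀ z ∈ U, conj z ∈ U := fun z hz => hΩ.conj_mem hI hz
  have hO : IsOpen (Ω \ realAxis) := hΩ.isOpen.sdiff isClosed_realAxis
  have hW : IsOpen (U ∩ {z | z.im ≠ 0}) :=
    hU.inter (isOpen_ne.preimage Complex.continuous_im)
  have hOW : ∀ q ∈ Ω \ realAxis, sliceCoord q ∈ U ∩ {z | z.im ≠ 0} := fun q hq =>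
    ⟨hΩ.sliceCoord_mem hI hq.1, by simpa [realAxis, sliceCoord] using hq.2⟩
  have hβ : ContDiffOn ℝ ω (oddPart e₁ h) (U ∩ {z | z.im ≠ 0}) :=
    (contDiffOn_oddPart hconj (hh.contDiffOn hI hU)).mono Set.inter_subset_left
  set b : ℂ → ℍ := fun z => z.im⁻¹ • oddPart e₁ h z with hb
  have hbc : ContDiffOn ℝ ω b (U ∩ {z | z.im ≠ 0}) := contDiffOn_inv_im_smul (fun z hz => hz.2) hβ
  have hoff : ∀ q ∈ Ω \ realAxis, cauchyFueter (Laplacian.laplacian φ) q = 0 := by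
    intro q hq
    have h1 : Set.EqOn (cauchyFueter φ) ((-2 : ℝ) • (b ∘ sliceCoord)) (Ω \ realAxis) :=
      fun p hp => cauchyFueter_eq_neg_two_smul hΩ hI hh hext hp.1 hp.2
    have h2 : ContDiffAt ℝ 2 (b ∘ sliceCoord) q :=
      ((hbc.contDiffAt (hW.mem_nhds (hOW q hq))).comp q (contDiffAt_sliceCoord hq.2)).of_le le_top
    rw [cauchyFueter_laplacian hΩ.isOpen hc hq.1, laplacian_eqOn hO h1 hq,
      InnerProductSpace.laplacian_smul _ h2,
      laplacian_comp_sliceCoord hW hO (fun p hp => hp.2) hOW hbc hq]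
    have h3 := laplacian_inv_im_smul hW (fun z hz => hz.2) hβ (hOW q hq)
      (oddPart_harmonic hI hU hconj hh (hOW q hq).1)
    rw [show ‖q.im‖ = (sliceCoord q).im from rfl, h3, smul_zero]
  intro q hq
  have hcont : ContinuousAt (cauchyFueter (Laplacian.laplacian φ)) q :=
    (contDiffOn_cauchyFueter hΩ.isOpen
      (contDiffOn_laplacian hΩ.isOpen hc)).continuousOn.continuousAt (hΩ.isOpen.mem_nhds hq)
  have := nhdsWithin_compl_realAxis_neBot q
  refine tendsto_nhds_unique (hcont.tendsto.mono_left nhdsWithin_le_nhds)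
    (tendsto_const_nhds.congr' ?_) (l := 𝓝[realAxisᶜ] q)
  filter_upwards [self_mem_nhdsWithin, nhdsWithin_le_nhds (hΩ.isOpen.mem_nhds hq)] with p hp hpΩ
  exact (hoff p ⟨hpΩ, hp⟩).symm

/-! ### Powers of `x₀` times Fueter regular functions -/

lemma hasFDerivAt_re_pow (j : ℕ) (q : ℍ) :
    HasFDerivAt (fun p : ℍ => p.re ^ j) (((j : ℝ) * q.re ^ (j - 1)) • reL) q := by
  have h := (hasDerivAt_pow j (reL q)).comp_hasFDerivAt q reL.hasFDerivAt
  rw [coe_reL] at h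
  exact h

lemma contDiffOn_sum_re_pow {n : ℕ} {g : ℕ → ℍ → ℍ} (hg : ∀ k < n, ContDiffOn ℝ ω (g k) Ω)
    (r : ℕ → ℝ) (j : ℕ → ℕ) :
    ContDiffOn ℝ ω (fun q => ∑ k ∈ Finset.range n, r k • (q.re ^ j k • g k q)) Ω := by
  have hre : ContDiff ℝ ω fun q : ℍ => q.re := coe_reL ▸ reL.contDiff
  exact ContDiffOn.sum fun k hk => ContDiffOn.const_smul (r k)
    ((hre.pow (j k)).contDiffOn.smul (hg k (Finset.mem_range.1 hk)))

lemma cauchyFueter_sum_re_pow (hΩ : IsOpen Ω) {n : ℕ} {g : ℕ → ℍ → ℍ}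
    (hg : ∀ k < n, ContDiffOn ℝ ω (g k) Ω) (hD : ∀ k < n, ∀ q ∈ Ω, cauchyFueter (g k) q = 0)
    (r : ℕ → ℝ) (j : ℕ → ℕ) :
    Set.EqOn (cauchyFueter fun q => ∑ k ∈ Finset.range n, r k • (q.re ^ j k • g k q))
      (fun q => ∑ k ∈ Finset.range n, (r k * (1 * j k)) • (q.re ^ (j k - 1) • g k q)) Ω := by
  intro q hq
  have hd : ∀ k ∈ Finset.range n, DifferentiableAt ℝ (g k) q := fun k hk =>
    (hg k (Finset.mem_range.1 hk)).differentiableAt_of_omega hΩ hq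
  have hd' : ∀ k ∈ Finset.range n, DifferentiableAt ℝ (fun p : ℍ => p.re ^ j k • g k p) q :=
    fun k hk => (hasFDerivAt_re_pow (j k) q).differentiableAt.smul (hd k hk)
  have key : ∀ v : ℍ,
      dirDeriv v (fun q => ∑ k ∈ Finset.range n, r k • (q.re ^ j k • g k q)) q =
        ∑ k ∈ Finset.range n, r k • (q.re ^ j k • dirDeriv v (g k) q +
          (j k * q.re ^ (j k - 1) * v.re) • g k q) := by
    intro v
    rw [dirDeriv_fun_sum fun k hk => (hd' k hk).fun_const_smul (r k)]
    refine Finset.sum_congr rfl fun k hk => ?_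
    rw [dirDeriv, fderiv_fun_const_smul (hd' k hk), smul_apply]
    congr 1
    have := dirDeriv_smul (hasFDerivAt_re_pow (j k) q) (hd k hk) v
    rw [smul_apply, reL_apply, smul_eq_mul] at this
    exact this
  simp only [cauchyFueter_eq_sum, key, Finset.mul_sum]
  rw [Finset.sum_comm]
  refine Finset.sum_congr rfl fun k hk => ?_
  have h0 := hD k (Finset.mem_range.1 hk) q hq
  rw [cauchyFueter_eq_sum] at h0
  simp only [mul_smul_comm, mul_add, smul_add, Finset.sum_add_distrib, ← Finset.smul_sum, h0,
    smul_zero, zero_add]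
  rw [Fin.sum_univ_four]
  simp [stdBasis, smul_smul, mul_assoc]

/-- `𝒟^m ∑ x₀^k g_k = ∑ k!/(k-m)! x₀^(k-m) g_k` for Fueter regular `g_k`. -/
lemma cauchyFueter_iterate (hΩ : IsOpen Ω) {n : ℕ} {g : ℕ → ℍ → ℍ}
    (hg : ∀ k < n, ContDiffOn ℝ ω (g k) Ω) (hD : ∀ k < n, ∀ q ∈ Ω, cauchyFueter (g k) q = 0)
    {F : ℍ → ℍ} (hF : ∀ q ∈ Ω, F q = ∑ k ∈ Finset.range n, q.re ^ k • g k q) (m : ℕ) :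
    ∀ q ∈ Ω, cauchyFueter^[m] F q = ∑ k ∈ Finset.range n,
      (1 ^ m * k.descFactorial m : ℝ) • (q.re ^ (k - m) • g k q) :=
  iterate_eqOn_sum (T := cauchyFueter) (b := fun j k q => q.re ^ j • g k q)
    (fun _ _ => cauchyFueter_eqOn hΩ) (cauchyFueter_sum_re_pow hΩ hg hD) hF m

lemma cauchyFueter_const_smul (c : ℝ) (g : ℍ → ℍ) :
    cauchyFueter (c • g) = c • cauchyFueter g := by
  funext q
  simp only [cauchyFueter, fderiv_const_smul_field, smul_apply, mul_smul_comm, Pi.smul_apply,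
    smul_add]

lemma two_smul_cauchyFueter_iterate (m : ℕ) (g : ℍ → ℍ) :
    (fun g p => (2 : ℝ) • cauchyFueter g p)^[m] g = (2 ^ m : ℝ) • cauchyFueter^[m] g := by
  induction m with
  | zero => simp
  | succ m ih =>
    rw [Function.iterate_succ_apply', Function.iterate_succ_apply', ih, cauchyFueter_const_smul,
      pow_succ', mul_smul]
    rfl

lemma IsPolyDecomposition.cauchyFueter_iterate_sum (hΩ : IsAxSymSliceDomain Ω) {n : ℕ} {f : ℍ → ℍ}
    {ψ : ℕ → ℍ → ℍ} (hψ : IsPolyDecomposition n Ω f ψ) (m : ℕ) :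
    ∀ q ∈ Ω, cauchyFueter^[m]
      (fun q => ∑ k ∈ Finset.range n, q.re ^ k • Laplacian.laplacian (ψ k) q) q =
      ∑ k ∈ Finset.range n,
        (1 ^ m * k.descFactorial m : ℝ) • (q.re ^ (k - m) • Laplacian.laplacian (ψ k) q) :=
  cauchyFueter_iterate hΩ.isOpen
    (fun k hk => contDiffOn_laplacian hΩ.isOpen ((hψ.1 k hk).contDiffOn hΩ))
    (fun k hk => cauchyFueter_laplacian_eq_zero hΩ (hψ.1 k hk)) (fun _ _ => rfl) m

end

end PolyFueter

end

/-! ### The two poly-Fueter maps -/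

open scoped ContDiff

theorem mainTheorem4 (n : ℕ) (hn : 1 ≤ n) (Ω : Set ℍ) (hΩ : IsAxSymSliceDomain Ω)
    (f : ℍ → ℍ) (hf : IsSlicePolyanalytic n Ω f) :
    -- the poly-decomposition exists and is unique, so that `C_n f` is well defined
    (∃ φ, IsPolyDecomposition n Ω f φ) ∧
    (∀ φ ψ, IsPolyDecomposition n Ω f φ → IsPolyDecomposition n Ω f ψ →
      ∀ k < n, Set.EqOn (φ k) (ψ k) Ω) ∧
    -- `V f, …, V ^ (n - 1) f` are functions on `Ω`, the last one of class `C²`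
    (∀ m < n - 1, IsVAdmissible Ω (globalV^[m] f)) ∧
    ContDiffOn ℝ 2 (globalV^[n - 1] f) Ω ∧
    -- the two poly-Fueter maps take values in `FR_n(Ω)` and `FR(Ω)`
    IsPolyFueterRegular n Ω (polyFueterC n Ω f) ∧
    IsPolyFueterRegular 1 Ω (polyFueterTau n f) ∧
    -- the identity and the commutative diagram
    (∀ q ∈ Ω, cauchyFueter^[n - 1] (polyFueterC n Ω f) q =
      (1 / 2 ^ (n - 1) : ℝ) • polyFueterTau n f q) ∧
    (∀ q ∈ Ω, (fun g p => (2 : ℝ) • cauchyFueter g p)^[n - 1] (polyFueterC n Ω f) q =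
      polyFueterTau n f q) ∧
    -- both sides in terms of the top component of the poly-decomposition
    (∀ φ, IsPolyDecomposition n Ω f φ →
      (∀ k < n, IsSliceFunction Ω (φ k) ∧ ContDiffOn ℝ 2 (φ k) Ω) ∧
      ∀ q ∈ Ω,
        polyFueterC n Ω f q =
          ∑ k ∈ Finset.range n, q.re ^ k • Laplacian.laplacian (φ k) q ∧
        cauchyFueter^[n - 1] (polyFueterC n Ω f) q =
          ((n - 1).factorial : ℝ) • Laplacian.laplacian (φ (n - 1)) q ∧
        polyFueterTau n f q =
          (2 ^ (n - 1) * (n - 1).factorial : ℝ) •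
            Laplacian.laplacian (φ (n - 1)) q) := by
  have hV := fun {φ} (h : IsPolyDecomposition n Ω f φ) (m : ℕ) => contDiffOn_globalV_iterate hΩ h m
  have hex := exists_isPolyDecomposition hΩ hf
  have huniq : ∀ φ ψ, IsPolyDecomposition n Ω f φ → IsPolyDecomposition n Ω f ψ →
      ∀ k < n, Set.EqOn (φ k) (ψ k) Ω := fun φ ψ h1 h2 => h1.eqOn hΩ h2
  have hχ : IsPolyDecomposition n Ω f (polyComponent n Ω f) := Classical.epsilon_spec hex
  set χ := polyComponent n Ω f with hχ_def
  have hC : polyFueterC n Ω f =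
      fun q => ∑ k ∈ Finset.range n, q.re ^ k • Laplacian.laplacian (χ k) q := rfl
  have hlap : ∀ k < n, ContDiffOn ℝ ω (Laplacian.laplacian (χ k)) Ω := fun k hk =>
    contDiffOn_laplacian hΩ.isOpen ((hχ.1 k hk).contDiffOn hΩ)
  have hCs : ContDiffOn ℝ ω (polyFueterC n Ω f) Ω := by
    rw [hC]
    simpa using contDiffOn_sum_re_pow hlap (fun _ => 1) id
  have hn1 : n - 1 < n := by omega
  have hDC : ∀ q ∈ Ω, cauchyFueter^[n - 1] (polyFueterC n Ω f) q =
      ((n - 1).factorial : ℝ) • Laplacian.laplacian (χ (n - 1)) q := by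
    intro q hq
    rw [hC, hχ.cauchyFueter_iterate_sum hΩ (n - 1) q hq]
    have := sum_descFactorial_pred hn (1 ^ (n - 1)) fun j k =>
      q.re ^ j • Laplacian.laplacian (χ k) q
    rw [this, one_pow, one_mul, pow_zero, one_smul]
  have hτ : Set.EqOn (polyFueterTau n f)
      ((2 ^ (n - 1) * (n - 1).factorial : ℝ) • Laplacian.laplacian (χ (n - 1))) Ω := by
    intro q hq
    rw [polyFueterTau, laplacian_eqOn hΩ.isOpen (globalV_iterate_pred hΩ hn hχ) hq]
    exact InnerProductSpace.laplacian_smul _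
      ((((hχ.1 _ hn1).contDiffOn hΩ).contDiffAt (hΩ.isOpen.mem_nhds hq)).of_le le_top)
  have hDτ : ∀ q ∈ Ω, (2 ^ (n - 1) : ℝ) • cauchyFueter^[n - 1] (polyFueterC n Ω f) q =
      polyFueterTau n f q := by
    intro q hq
    rw [hDC q hq, hτ hq, smul_smul]
    rfl
  refine ⟨hex, huniq, fun m _ => ⟨?_, ?_⟩, (hV hχ _).of_le le_top,
    ⟨hCs.of_le le_top, fun q hq => ?_⟩, ⟨?_, fun q hq => ?_⟩, fun q hq => ?_, fun q hq => ?_,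
    fun φ hφ => ⟨fun k hk => ⟨(hφ.1 k hk).isSliceFunction hΩ,
      ((hφ.1 k hk).contDiffOn hΩ).of_le le_top⟩, fun q hq => ?_⟩⟩
  · exact ((hV hχ m).mono Set.sdiff_subset).of_le le_top
  · rw [← Function.iterate_succ_apply' (f := globalV)]
    exact (hV hχ (m + 1)).continuousOn
  · rw [hC, hχ.cauchyFueter_iterate_sum hΩ n q hq]
    exact sum_descFactorial_self n (1 ^ n) fun j k => q.re ^ j • Laplacian.laplacian (χ k) q
  · refine ContDiffOn.of_le ?_ le_top
    exact ((hlap _ hn1).const_smul (2 ^ (n - 1) * (n - 1).factorial : ℝ)).congr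
      fun q hq => hτ hq
  · rw [Function.iterate_one, cauchyFueter_eqOn hΩ.isOpen hτ hq, cauchyFueter_const_smul,
      Pi.smul_apply, cauchyFueter_laplacian_eq_zero hΩ (hχ.1 _ hn1) q hq, smul_zero]
  · rw [← hDτ q hq, smul_smul, one_div, inv_mul_cancel₀ (by positivity), one_smul]
  · rw [two_smul_cauchyFueter_iterate, Pi.smul_apply, hDτ q hq]
  · have hk : ∀ k < n, Laplacian.laplacian (χ k) q = Laplacian.laplacian (φ k) q :=
      fun k hk => laplacian_eqOn hΩ.isOpen (huniq _ _ hχ hφ k hk) hq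
    refine ⟨?_, ?_, ?_⟩
    · rw [hC]
      exact Finset.sum_congr rfl fun k hk' => by rw [hk k (Finset.mem_range.1 hk')]
    · rw [hDC q hq, hk _ hn1]
    · rw [hτ hq, Pi.smul_apply, hk _ hn1]
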